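/- Let $n\ge 1$ and $a$ be integers such that $x^n-a$ is irreducible in $\mathbb Z[x]$, let $\theta$ be a root of $x^n-a$, and let $K=\mathbb Q(\theta)$, with (absolute) discriminant $d_K$. Let $n=\prod_{i=1}^k p_i^{s_i}$ and $|a|=\prod_{j=1}^l q_j^{t_j}$ be the prime factorizations of $n$ and $|a|$, and write $v_p$ for the $p$-adic valuation. Put $m_j=\gcd(n,t_j)$, $n_i=n/p_i^{s_i}$ and $r_i=v_{p_i}(a^{p_i-1}-1)-1$. Assume that for each $i$ either $p_i\nmid a$ or $v_{p_i}(a)$ is coprime to $p_i$. Then $$d_K=(-1)^{\frac{(n-1)(n-2)}{2}}\,\operatorname{sgn}(a^{n-1})\,\Big(\prod_{i=1}^k p_i^{v_i}\Big)\prod_{j=1}^l q_j^{\,n-m_j},$$ where $$v_i=\begin{cases} n s_i-2n_i\displaystyle\sum_{j=1}^{\min\{r_i,s_i\}}p_i^{\,s_i-j} & \text{if } r_i>0,\\ n s_i & \text{otherwise.}\end{cases}$$ (If $a=0$, then $n=1$ by irreducibility; in this case $a^{n-1}$ is read as $1$ and the product over the $q_j$ as empty.) -/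

import Mathlib

/-- The integer `r = v_p(a^(p-1) - 1) - 1`; it equals `-1` when `p` divides `a`. -/
def wieferichExcess (a : ℤ) (p : ℕ) : ℤ :=
  (padicValInt p (a ^ (p - 1) - 1) : ℤ) - 1

/-- With `s = v_p(n)`, `n' = n / p^s` and `r = v_p(a^(p-1) - 1) - 1`, the integer
`n * s - 2 * n' * ∑_{j=1}^{min(r,s)} p^(s-j)` if `r > 0`, and `n * s` otherwise. -/
def pureDiscrExponent (n : ℕ) (a : ℤ) (p : ℕ) : ℤ :=
  let s : ℕ := n.factorization p
  let r : ℤ := wieferichExcess a p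
  if 0 < r then
    (n : ℤ) * s - 2 * ((n / p ^ s : ℕ) : ℤ) *
      ∑ j ∈ Finset.Icc 1 (min r.toNat s), (p : ℤ) ^ (s - j)
  else (n : ℤ) * s

/-!
The discriminant of the order `ℤ[θ]` is `± n ^ n * a ^ (n - 1)`, and it equals the discriminant of
`K` times the square of the index of `ℤ[θ]` in `𝓞 K`. So the formula amounts to computing, for every
prime `p`, the `p`-part of this index. This is done by exhibiting, for every `d < n`, a monic integer
polynomial `G` of degree `d` such that `G(θ) / p ^ e d` is integral, and by showing that `e d` is the
largest possible exponent: the leading coefficient of an `H ∈ ℤ[X]` of degree `d` such that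
`H(θ) / p ^ k` is integral is divisible by `p ^ (k - e d)`. The `p`-part of the index is then
`p ^ ∑ e d` (`discr_pow_eq_of_leadingCoeff`).

For the maximality of `e d`, an integral equation of `H(θ) / p ^ k` over `ℤ` remains valid in every
ring that contains a root of `X ^ n - a` (`exists_monic_scaleRoots_eval_eq_zero`). It is used in
rings `A`, finite and free over an unramified extension of `ℤ_p`, that are known to contain every
element of `A[1/p]` that is integral over them; this is a criterion of Dedekind type
(`dvd_of_isIntegral_of_smul_eq`, `isSaturatedAt_adjoinRoot`, `isSaturatedAt_eisenstein`).
There `H(θ) / p ^ k ∈ A` can be read off on a basis.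

* If `p` divides `a`, with `v_p(a) = t`, the polynomials are `G = X ^ d` with `e d = ⌊d t / n⌋`. The
  hypothesis says that `p` does not divide `g = gcd(n, t)`, so that a `g`-th root of the prime-to-`p`
  part of `a` is unramified, and over it `θ` is a unit times a power of the root of an Eisenstein
  polynomial of degree `n / g` (`discr_pow_eq_of_dvd`). The sum of the `⌊d t / n⌋` is elementary
  (`two_mul_sum_div_add`).
* If `p` divides `n` but not `a`, write `n = n' * p ^ s`, `r = v_p(a ^ (p - 1) - 1) - 1` and
  `m = min r s`. For `j ≤ m` and `Y = θ ^ (n / p ^ j)` the element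
  `(Y ^ (p ^ j - 1) + a Y ^ (p ^ j - 2) + ⋯ + a ^ (p ^ j - 1)) / p ^ j` is integral, by an explicit
  equation (`isIntegral_geomSum_div`); these elements and their products with powers of `θ` give
  the exponents `stepCount`. On the other side, `a = c ^ p ^ m` in `ℤ_p`, or in `ℤ_2[ω]` with
  `ω ^ 2 + ω + 1 = 0` in one case for `p = 2`, and `X ^ n - a` is a product of `m + 1` factors,
  `radicalFactor`, each of which defines a maximal order. As each factor is `p` times a unit modulo
  any earlier one, an induction on the number of factors bounds the leading coefficient
  (`pow_dvd_leadingCoeff_of_forall_radicalFactor`, `discr_pow_eq_of_not_dvd`).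

The primes that divide neither `n` nor `a` do not divide `n ^ n * a ^ (n - 1)`, and the sign of `d_K`
is that of the discriminant of `ℤ[θ]`.
-/

/-! ### Divisibility by a prime in the integral closure -/

/-- A Dedekind-type criterion for `p`-maximality. If `φ ^ e` is `p` times an element that is a unit
modulo `(φ, p)`, and `A / (φ, p)` is reduced (the quotient is realised by `π`), then no element of
`p⁻¹ A` outside `A` is integral over `A`. -/
theorem dvd_of_isIntegral_of_smul_eq {A B Q : Type*} [CommRing A] [CommRing B] [CommRing Q]
    [IsReduced Q] [Algebra A B] (hinj : Function.Injective (algebraMap A B)) {p φ F : A} {e : ℕ}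
    (hp : ∀ b : B, algebraMap A B p * b = 0 → b = 0) (hφ : φ ^ e = p * F)
    (π : A →+* Q) (hker : ∀ z, π z = 0 → z ∈ Ideal.span {φ, p}) (hπφ : π φ = 0)
    (hF : IsUnit (π F)) {x : B} {z : A} (hx : IsIntegral A x)
    (hz : algebraMap A B p * x = algebraMap A B z) : p ∣ z := by
  classical
  -- the largest `j ≤ e` with `z ∈ (φ ^ j, p)`
  let T : ℕ → Prop := fun j => ∃ h w, z = φ ^ j * h + p * w
  have hT0 : T 0 := ⟨z, 0, by simp⟩
  by_cases hTe : T e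
  · obtain ⟨h, w, rfl⟩ := hTe
    exact ⟨F * h + w, by rw [hφ]; ring⟩
  exfalso
  obtain ⟨j, hj, hTj, hTj'⟩ : ∃ j, j < e ∧ T j ∧ ¬ T (j + 1) := by
    by_contra hcon
    push Not at hcon
    exact hTe (Nat.le_induction (P := fun i _ => i ≤ e → T i) (fun _ => hT0)
      (fun i _ ih hi => hcon i hi (ih (by omega))) e (Nat.zero_le _) le_rfl)
  obtain ⟨h, w, rfl⟩ := hTj
  set ι := algebraMap A B with hι
  -- `x' = φ ^ (e - 1) * h / p` is integral, and `φ * x' = F * h`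
  set x' : B := ι (φ ^ (e - 1 - j)) * x - ι (φ ^ (e - 1 - j) * w) with hx'
  have hx'int : IsIntegral A x' := (isIntegral_algebraMap.mul hx).sub isIntegral_algebraMap
  have key : ι φ * x' = ι (F * h) := by
    have : ι p * (ι φ * x' - ι (F * h)) = 0 := by
      have h1 : ι p * (ι φ * x') = ι φ * ι (φ ^ (e - 1 - j)) * (ι p * x)
          - ι (p * φ * φ ^ (e - 1 - j) * w) := by
        rw [hx']; simp only [map_mul]; ring
      rw [mul_sub, h1, hz, ← map_mul, ← map_mul, ← map_mul, ← map_sub, ← map_sub]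
      have h2 : φ * φ ^ (e - 1 - j) * φ ^ j = p * F := by
        rw [← hφ, ← pow_succ', ← pow_add]; congr 1; omega
      rw [show φ * φ ^ (e - 1 - j) * (φ ^ j * h + p * w) - p * φ * φ ^ (e - 1 - j) * w - p * (F * h)
        = (φ * φ ^ (e - 1 - j) * φ ^ j) * h - p * (F * h) by ring, h2]
      simp [mul_assoc]
    exact sub_eq_zero.mp (hp _ this)
  obtain ⟨P, hPm, hP⟩ := hx'int
  have h3 : Polynomial.eval (F * h) (P.scaleRoots φ) = 0 := by
    apply hinj
    rw [map_zero, ← Polynomial.eval₂_at_apply, ← key]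
    have := Polynomial.scaleRoots_eval₂_mul (p := P) ι x' φ
    rw [this, hP, mul_zero]
  have h4 : (π (F * h)) ^ P.natDegree = 0 := by
    have h5 := congrArg π h3
    rw [map_zero, ← Polynomial.eval₂_at_apply, Polynomial.eval₂_eq_sum_range,
      Finset.sum_range_succ, Polynomial.natDegree_scaleRoots, Finset.sum_eq_zero, zero_add] at h5
    · simpa [Polynomial.coeff_scaleRoots, hPm.coeff_natDegree] using h5
    · intro i hi
      rw [Finset.mem_range] at hi
      rw [Polynomial.coeff_scaleRoots, map_mul, map_pow, hπφ, zero_pow (by omega)]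
      simp
  have h6 : π h = 0 := by
    have h7 : π (F * h) = 0 := IsReduced.eq_zero _ ⟨_, h4⟩
    rw [map_mul] at h7
    exact (hF.mul_right_eq_zero).mp h7
  obtain ⟨u, v, huv⟩ := Ideal.mem_span_pair.mp (hker _ h6)
  refine hTj' ⟨u, φ ^ j * v + w, ?_⟩
  rw [← huv]; ring

/-- The criterion of `dvd_of_isIntegral_of_smul_eq`, applied repeatedly in `A[1/p]`: if `z / p ^ k`
is a root of the monic polynomial `P`, then `p ^ k ∣ z`. -/
theorem pow_dvd_of_scaleRoots_eval_eq_zero {A Q : Type*} [CommRing A] [CommRing Q]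
    [IsReduced Q] {p φ F : A} {e : ℕ} (hp : p ∈ nonZeroDivisors A)
    (hφ : φ ^ e = p * F) (π : A →+* Q) (hker : ∀ z, π z = 0 → z ∈ Ideal.span {φ, p})
    (hπφ : π φ = 0) (hF : IsUnit (π F)) {P : Polynomial A} (hP : P.Monic) (k : ℕ)
    {z : A} (hz : (P.scaleRoots (p ^ k)).eval z = 0) : p ^ k ∣ z := by
  let B := Localization.Away p
  have hinj : Function.Injective (algebraMap A B) :=
    IsLocalization.injective B (Submonoid.powers_le.mpr hp)
  set ι := algebraMap A B with hι
  have hu : IsUnit (ι p) := IsLocalization.Away.algebraMap_isUnit p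
  have hp' : ∀ b : B, ι p * b = 0 → b = 0 := fun b hb => by
    simpa using (hu.mul_right_eq_zero).mp hb
  obtain ⟨v, hv⟩ := hu.exists_right_inv
  set x : B := ι z * v ^ k with hx
  have hx1 : ι p ^ k * x = ι z := by
    rw [hx, mul_left_comm, ← mul_pow, hv, one_pow, mul_one]
  have hxint : IsIntegral A x := by
    refine ⟨P, hP, ?_⟩
    have h1 := Polynomial.scaleRoots_eval₂_mul (p := P) ι x (p ^ k)
    rw [map_pow, hx1, Polynomial.eval₂_at_apply, hz, map_zero] at h1
    have h2 : IsUnit ((ι p ^ k) ^ P.natDegree) := (hu.pow k).pow _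
    exact (h2.mul_right_eq_zero).mp h1.symm
  clear_value x
  clear hz hx
  induction k generalizing z with
  | zero => simp
  | succ k ih =>
    have h1 : p ∣ z := by
      refine dvd_of_isIntegral_of_smul_eq hinj hp' hφ π hker hπφ hF
        (x := ι (p ^ k) * x) (isIntegral_algebraMap.mul hxint) ?_
      rw [← hx1, map_pow]; ring
    obtain ⟨z', rfl⟩ := h1
    rw [pow_succ']
    refine mul_dvd_mul_left p (ih ?_)
    have : ι p * (ι p ^ k * x - ι z') = 0 := by
      rw [mul_sub, ← map_mul, ← hx1]; ring
    exact sub_eq_zero.mp (hp' _ this)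

/-! ### The `p`-part of the index of a power basis -/

open Polynomial NumberField in
/-- Let `G d / p ^ e d`, with `G d` monic of degree `d`, be integral at `θ` for `d < n`, and suppose
that the leading coefficient of an integral `H(θ) / p ^ k` with `d = deg H < n` lies in
`p ^ (-e d) ℤ_(p)`. Then the elements `G d (θ) / p ^ e d` generate a sublattice of `𝓞 K` of index
prime to `p`; the discriminants of `1, θ, …, θ ^ (n - 1)` and of `K` are compared accordingly. -/
theorem discr_pow_eq_of_leadingCoeff {K : Type*} [Field K] [NumberField K] {n : ℕ}
    (hn : Module.finrank ℚ K = n) (θ : 𝓞 K) {p : ℕ} (hp : p.Prime) (e : ℕ → ℕ) (G : ℕ → ℤ[X])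
    (hG : ∀ d < n, (G d).Monic ∧ (G d).natDegree = d ∧
      ∃ y : 𝓞 K, (p : 𝓞 K) ^ e d * y = aeval θ (G d))
    (hL : ∀ H : ℤ[X], H.natDegree < n → ∀ (k : ℕ) (y : 𝓞 K), (p : 𝓞 K) ^ k * y = aeval θ H →
      (p : ℤ) ^ k ∣ (p : ℤ) ^ e H.natDegree * H.leadingCoeff) :
    ∃ D : ℤ, ¬ (p : ℤ) ∣ D ∧ Algebra.discr ℤ (fun i : Fin n => θ ^ (i : ℕ)) =
      (p : ℤ) ^ (2 * ∑ d ∈ Finset.range n, e d) * D ^ 2 * discr K := by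
  classical
  have : Fact p.Prime := ⟨hp⟩
  choose! hGm hGd y hy using hG
  have hcard : Fintype.card (Module.Free.ChooseBasisIndex ℤ (𝓞 K)) = Fintype.card (Fin n) := by
    rw [← Module.finrank_eq_card_chooseBasisIndex, RingOfIntegers.rank, hn, Fintype.card_fin]
  let ω : Module.Basis (Fin n) ℤ (𝓞 K) :=
    (RingOfIntegers.basis K).reindex (Fintype.equivOfCardEq hcard)
  let β : Fin n → 𝓞 K := fun i => y i
  let T : Matrix (Fin n) (Fin n) ℤ := Matrix.of fun i j => ω.repr (β i) j
  let C : Matrix (Fin n) (Fin n) ℤ := Matrix.of fun i j => (G i).coeff j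
  have hTβ : (T.map (algebraMap ℤ (𝓞 K))).mulVec ω = β := by
    ext1 i
    rw [← ω.sum_repr (β i)]
    simp [Matrix.mulVec, dotProduct, T, Algebra.smul_def]
  have hC : (C.map (algebraMap ℤ (𝓞 K))).mulVec (fun i : Fin n => θ ^ (i : ℕ)) =
      ((Matrix.diagonal fun i : Fin n => (p : ℤ) ^ e i).map (algebraMap ℤ (𝓞 K))).mulVec β := by
    ext1 i
    have h1 : ((Matrix.diagonal fun i : Fin n => (p : ℤ) ^ e i).map
        (algebraMap ℤ (𝓞 K))).mulVec β i = aeval θ (G i) := by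
      rw [← hy i i.2]
      simp [Matrix.mulVec, dotProduct, Matrix.diagonal_apply, Finset.sum_ite_eq, β, apply_ite,
        ite_mul]
    rw [h1, aeval_eq_sum_range' (n := n) (by rw [hGd i i.2]; exact i.2), Finset.sum_range]
    simp [Matrix.mulVec, dotProduct, C, Algebra.smul_def]
  have hCdet : C.det = 1 := by
    rw [Matrix.det_of_isLowerTriangular]
    · refine Finset.prod_eq_one fun i _ => ?_
      have := (hGm i i.2).coeff_natDegree
      rw [hGd i i.2] at this
      simpa [C] using this
    · intro i j hij
      refine coeff_eq_zero_of_natDegree_lt ?_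
      rw [hGd i i.2]
      exact hij
  refine ⟨T.det, ?_, ?_⟩
  · intro hdvd
    have h0 : (T.map (Int.castRingHom (ZMod p))).det = 0 := by
      have := (Int.castRingHom (ZMod p)).map_det T
      rw [RingHom.mapMatrix_apply] at this
      rw [← this]
      exact (ZMod.intCast_zmod_eq_zero_iff_dvd _ _).mpr hdvd
    -- a relation modulo `p` between the rows of `T` shows that a combination of the `β i` with
    -- coefficients not all divisible by `p` is `p` times an integer of `K`
    obtain ⟨v, hv0, hv⟩ := Matrix.exists_vecMul_eq_zero_iff.mpr h0
    let V : Fin n → ℤ := fun i => ((v i).val : ℤ)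
    have hV : ∀ i, ((V i : ℤ) : ZMod p) = v i := fun i => by simp [V]
    have h1 : ∀ j, (p : ℤ) ∣ ∑ i, V i * T i j := by
      intro j
      rw [← ZMod.intCast_zmod_eq_zero_iff_dvd]
      have := congrFun hv j
      simpa [Matrix.vecMul, dotProduct, hV] using this
    choose w hw using h1
    have h2 : ∑ i, (V i : 𝓞 K) * β i = p * ∑ j, (w j : 𝓞 K) * ω j := by
      rw [← hTβ, Finset.mul_sum]
      simp only [Matrix.mulVec, dotProduct, Finset.mul_sum]
      rw [Finset.sum_comm]
      refine Finset.sum_congr rfl fun j _ => ?_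
      rw [← mul_assoc]
      have := congrArg (fun z : ℤ => (z : 𝓞 K)) (hw j)
      push_cast at this
      rw [← this, Finset.sum_mul]
      refine Finset.sum_congr rfl fun i _ => ?_
      simp [mul_assoc]
    obtain ⟨d, hd, hdmax⟩ : ∃ d, v d ≠ 0 ∧ ∀ i, d < i → v i = 0 := by
      have hne : (Finset.univ.filter fun i => v i ≠ 0).Nonempty := by
        obtain ⟨i, hi⟩ := Function.ne_iff.mp hv0
        exact ⟨i, by simpa using hi⟩
      refine ⟨_, (Finset.mem_filter.mp (Finset.max'_mem _ hne)).2, fun i hi => ?_⟩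
      by_contra hi0
      exact absurd (Finset.le_max' _ i (by simpa using hi0)) (not_le.mpr hi)
    set E := ∑ i : Fin n, e i with hE
    have hle : ∀ i : Fin n, e i ≤ E := fun i =>
      Finset.single_le_sum (f := fun i : Fin n => e i) (fun _ _ => Nat.zero_le _)
        (Finset.mem_univ i)
    let H : ℤ[X] := ∑ i : Fin n, Polynomial.C (V i * (p : ℤ) ^ (E - e i)) * G i
    have hH : aeval θ H = (p : 𝓞 K) ^ (E + 1) * ∑ j, (w j : 𝓞 K) * ω j := by
      rw [pow_succ, mul_assoc, ← h2, Finset.mul_sum, map_sum]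
      refine Finset.sum_congr rfl fun i _ => ?_
      rw [map_mul, aeval_C, ← hy i i.2]
      simp only [map_mul, map_pow, eq_intCast, Int.cast_natCast, β]
      rw [show (p : 𝓞 K) ^ E = p ^ (E - e i) * p ^ e i by
        rw [← pow_add, Nat.sub_add_cancel (hle i)]]
      ring
    have hVne : V d ≠ 0 := fun h => hd (by rw [← hV, h, Int.cast_zero])
    have hcoeff : H.coeff d = V d * (p : ℤ) ^ (E - e d) := by
      rw [finsetSum_coeff, Finset.sum_eq_single d]
      · have := (hGm d d.2).coeff_natDegree
        rw [hGd d d.2] at this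
        rw [coeff_C_mul, this, mul_one]
      · intro i _ hid
        rcases lt_or_gt_of_ne hid with h | h
        · rw [coeff_C_mul, coeff_eq_zero_of_natDegree_lt, mul_zero]
          rw [hGd i i.2]
          exact h
        · simp [V, hdmax i h]
      · simp
    have hdeg : H.natDegree = d := by
      refine natDegree_eq_of_le_of_coeff_ne_zero ?_ ?_
      · refine natDegree_sum_le_of_forall_le _ _ fun i _ => ?_
        by_cases h : d < i
        · simp [V, hdmax i h]
        · refine (natDegree_C_mul_le _ _).trans ?_
          rw [hGd i i.2]
          exact not_lt.mp h
      · rw [hcoeff]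
        exact mul_ne_zero hVne (pow_ne_zero _ (by exact_mod_cast hp.ne_zero))
    have h3 := hL H (by rw [hdeg]; exact d.2) (E + 1) _ hH.symm
    rw [leadingCoeff, hdeg, hcoeff, mul_left_comm, ← pow_add, Nat.add_sub_cancel' (hle d),
      pow_succ', mul_comm (V d)] at h3
    have h4 : (p : ℤ) ∣ V d := by
      rw [mul_comm] at h3
      exact (mul_dvd_mul_iff_left (pow_ne_zero E (by exact_mod_cast hp.ne_zero))).mp h3
    refine hd ?_
    rw [← hV]
    exact (ZMod.intCast_zmod_eq_zero_iff_dvd _ _).mpr h4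
  · have h1 : Algebra.discr ℤ ω = discr K := discr_eq_discr K ω
    have h2 := Algebra.discr_of_matrix_mulVec (A := ℤ) (fun i : Fin n => θ ^ (i : ℕ)) C
    have h3 := Algebra.discr_of_matrix_mulVec (A := ℤ) β
      (Matrix.diagonal fun i : Fin n => (p : ℤ) ^ e i)
    have h4 := Algebra.discr_of_matrix_mulVec (A := ℤ) ω T
    rw [hCdet, one_pow, one_mul, hC, h3] at h2
    rw [hTβ, h1] at h4
    rw [← h2, h4, Matrix.det_diagonal, Finset.prod_pow_eq_pow_sum, ← Finset.sum_range (f := e),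
      ← pow_mul, mul_comm 2]
    ring

/-! ### Factors of a polynomial `X ^ (n' * p ^ (k + m)) - c ^ p ^ m` -/

section RadicalFactor

open Polynomial

variable {R : Type*} [CommRing R]

/-- The homogenised cyclotomic factors of `X ^ (n' * p ^ (k + m)) - c ^ p ^ m`: with
`Y = X ^ (n' * p ^ k)`, the zeroth factor is `Y - c` and the `i`-th one is the homogenisation
of the `p ^ i`-th cyclotomic polynomial in `Y` and `c`. -/
noncomputable def radicalFactor (p n' k : ℕ) (c : R) : ℕ → R[X]
  | 0 => X ^ (n' * p ^ k) - C c
  | l + 1 => ∑ t ∈ Finset.range p,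
      (X ^ (n' * p ^ (k + l))) ^ t * (C (c ^ p ^ l)) ^ (p - 1 - t)

theorem radicalFactor_succ_mul (p n' k : ℕ) (c : R) (l : ℕ) :
    radicalFactor p n' k c (l + 1) * (X ^ (n' * p ^ (k + l)) - C (c ^ p ^ l)) =
      X ^ (n' * p ^ (k + (l + 1))) - C (c ^ p ^ (l + 1)) := by
  rw [radicalFactor, (Commute.all _ _).geom_sum₂_mul, ← pow_mul, ← C_pow, ← pow_mul, mul_assoc,
    ← pow_succ, ← pow_succ, add_assoc]

theorem radicalFactor_dvd (p n' k : ℕ) (c : R) {i l : ℕ} (h : i ≤ l) :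
    radicalFactor p n' k c i ∣ X ^ (n' * p ^ (k + l)) - C (c ^ p ^ l) := by
  induction l with
  | zero =>
    obtain rfl : i = 0 := by omega
    simp [radicalFactor]
  | succ l ih =>
    rw [← radicalFactor_succ_mul]
    rcases Nat.lt_or_ge l i with h' | h'
    · obtain rfl : i = l + 1 := by omega
      exact dvd_mul_right _ _
    · exact (ih h').mul_left _

theorem radicalFactor_monic {p n' : ℕ} (hp : 0 < p) (hn : 0 < n') (k : ℕ) (c : R) (i : ℕ) :
    (radicalFactor p n' k c i).Monic := by
  have hm : ∀ l, (X ^ (n' * p ^ (k + l)) - C (c ^ p ^ l) : R[X]).Monic := fun l =>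
    monic_X_pow_sub_C _ (Nat.mul_pos hn (pow_pos hp _)).ne'
  cases i with
  | zero => simpa [radicalFactor] using hm 0
  | succ l =>
    refine Monic.of_mul_monic_right (hm l) ?_
    rw [radicalFactor_succ_mul]
    exact hm (l + 1)

theorem natDegree_radicalFactor_succ [Nontrivial R] {p n' : ℕ} (hp : 0 < p) (hn : 0 < n') (k : ℕ)
    (c : R) (l : ℕ) :
    (radicalFactor p n' k c (l + 1)).natDegree = n' * p ^ (k + (l + 1)) - n' * p ^ (k + l) := by
  have h := congrArg natDegree (radicalFactor_succ_mul p n' k c l)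
  rw [(radicalFactor_monic hp hn k c (l + 1)).natDegree_mul (monic_X_pow_sub_C _
    (Nat.mul_pos hn (pow_pos hp _)).ne'), natDegree_X_pow_sub_C, natDegree_X_pow_sub_C] at h
  omega

/-- Modulo an earlier factor, the factor of index `l + 1` is `p` times a power of `c`, because the
two terms that it homogenises become equal there. -/
theorem mk_radicalFactor_succ (p n' k : ℕ) (c : R) {i l : ℕ} (h : i ≤ l) :
    AdjoinRoot.mk (radicalFactor p n' k c i) (radicalFactor p n' k c (l + 1)) =
      AdjoinRoot.mk _ (C (p * c ^ (p ^ l * (p - 1)))) := by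
  have h1 : AdjoinRoot.mk (radicalFactor p n' k c i) (X ^ (n' * p ^ (k + l))) =
      AdjoinRoot.mk _ (C (c ^ p ^ l)) :=
    AdjoinRoot.mk_eq_mk.mpr (radicalFactor_dvd p n' k c h)
  rw [radicalFactor, map_sum]
  simp only [map_mul, map_pow] at h1 ⊢
  rw [Finset.sum_congr rfl (g := fun _ => (AdjoinRoot.mk _ (C c)) ^ (p ^ l * (p - 1)))]
  · simp
  · intro t ht
    rw [Finset.mem_range] at ht
    rw [h1, ← pow_add, ← pow_mul]
    congr 2
    omega

/-- For an increasing sequence `N`, the number of `j ∈ [1, l]` with `N l - N (l - j) ≤ d`. -/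
def stepCount (N : ℕ → ℕ) (l d : ℕ) : ℕ :=
  ((Finset.Icc 1 l).filter fun j => N l - N (l - j) ≤ d).card

theorem stepCount_succ {N : ℕ → ℕ} (hN : Monotone N) (l d : ℕ)
    (h : N (l + 1) - N l ≤ d) :
    stepCount N (l + 1) d = stepCount N l (d - (N (l + 1) - N l)) + 1 := by
  have h1 : (Finset.Icc 1 (l + 1)).filter (fun j => N (l + 1) - N (l + 1 - j) ≤ d) =
      insert 1 (((Finset.Icc 1 l).filter
        (fun j => N l - N (l - j) ≤ d - (N (l + 1) - N l))).map ⟨(· + 1), add_left_injective 1⟩) := by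
    ext j
    simp only [Finset.mem_filter, Finset.mem_Icc, Finset.mem_insert, Finset.mem_map,
      Function.Embedding.coeFn_mk]
    constructor
    · rintro ⟨⟨hj1, hj2⟩, hj3⟩
      by_cases hj : j = 1
      · exact .inl hj
      · refine .inr ⟨j - 1, ⟨⟨by omega, by omega⟩, ?_⟩, by omega⟩
        have e1 : l - (j - 1) = l + 1 - j := by omega
        rw [e1]
        have := hN (show l + 1 - j ≤ l by omega)
        have := hN (show l ≤ l + 1 by omega)
        omega
    · rintro (rfl | ⟨j, ⟨⟨hj1, hj2⟩, hj3⟩, rfl⟩)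
      · exact ⟨⟨le_rfl, by omega⟩, by simpa using h⟩
      · refine ⟨⟨by omega, by omega⟩, ?_⟩
        have e1 : l + 1 - (j + 1) = l - j := by omega
        rw [e1]
        have := hN (show l - j ≤ l by omega)
        have := hN (show l ≤ l + 1 by omega)
        omega
  rw [stepCount, h1, Finset.card_insert_of_notMem, Finset.card_map, stepCount]
  simp

/-- The polynomial of degree `N l - N (l - j)` that is divisible by `p ^ j` in the ring of integers
can be used in every degree `d` with `stepCount N l d = j`. -/
theorem le_of_stepCount_eq {N : ℕ → ℕ} (hN : Monotone N) {l d j : ℕ}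
    (h : stepCount N l d = j) (hj : 0 < j) : N l - N (l - j) ≤ d := by
  by_contra hcon
  have h1 : (Finset.Icc 1 l).filter (fun i => N l - N (l - i) ≤ d) ⊆ Finset.Icc 1 (j - 1) := by
    intro i hi
    simp only [Finset.mem_filter, Finset.mem_Icc] at hi ⊢
    refine ⟨hi.1.1, ?_⟩
    by_contra hij
    have := hN (show l - i ≤ l - j by omega)
    omega
  have := Finset.card_le_card h1
  rw [← stepCount, h, Nat.card_Icc] at this
  omega

theorem stepCount_le (N : ℕ → ℕ) (l d : ℕ) : stepCount N l d ≤ l := by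
  refine (Finset.card_filter_le _ _).trans ?_
  simp

theorem sum_stepCount {N : ℕ → ℕ} (hN : Monotone N) (l : ℕ) :
    ∑ d ∈ Finset.range (N l), stepCount N l d = ∑ j ∈ Finset.Icc 1 l, N (l - j) := by
  simp only [stepCount, Finset.card_filter]
  rw [Finset.sum_comm]
  refine Finset.sum_congr rfl fun j _ => ?_
  rw [← Finset.card_filter]
  have h1 : (Finset.range (N l)).filter (fun d => N l - N (l - j) ≤ d) =
      Finset.Ico (N l - N (l - j)) (N l) := by
    ext d
    simp only [Finset.mem_filter, Finset.mem_range, Finset.mem_Ico]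
    omega
  rw [h1, Nat.card_Ico]
  have := hN (show l - j ≤ l by omega)
  omega

theorem pow_dvd_modByMonic {f G : R[X]} (hf : f.Monic) {x : R}
    (h : AdjoinRoot.mk f (C x) ∣ AdjoinRoot.mk f G) : C x ∣ G %ₘ f := by
  obtain ⟨z, hz⟩ := h
  obtain ⟨z, rfl⟩ := AdjoinRoot.mk_surjective z
  rw [← map_mul, AdjoinRoot.mk_eq_mk] at hz
  have h1 : G %ₘ f = (C x * z) %ₘ f := by
    rw [← sub_eq_zero, ← sub_modByMonic]
    exact (modByMonic_eq_zero_iff_dvd hf).mpr hz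
  rw [h1, ← smul_eq_C_mul, smul_modByMonic, smul_eq_C_mul]
  exact dvd_mul_right _ _

/-- A polynomial of degree `< n' * p ^ (k + l)` that is divisible by `p ^ κ` modulo each of the
first `l + 1` factors has leading coefficient divisible by `p ^ κ` up to a power of `p` given by
the degree. The induction splits off the last factor, which is `p` times a unit modulo the
previous ones. -/
theorem pow_dvd_leadingCoeff_of_forall_radicalFactor [Nontrivial R] {p n' : ℕ} (hp : 0 < p)
    (hn : 0 < n') (k : ℕ) {c : R} (hc : IsUnit c) (hpR : (p : R) ∈ nonZeroDivisors R) (κ l : ℕ)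
    (G : R[X]) (hG : G.natDegree < n' * p ^ (k + l))
    (h : ∀ i ≤ l, AdjoinRoot.mk (radicalFactor p n' k c i) (C ((p : R) ^ κ)) ∣
      AdjoinRoot.mk (radicalFactor p n' k c i) G) :
    (p : R) ^ κ ∣ (p : R) ^ stepCount (fun i => n' * p ^ (k + i)) l G.natDegree *
      G.leadingCoeff := by
  have hN : Monotone fun i => n' * p ^ (k + i) := fun i j hij =>
    Nat.mul_le_mul_left _ (Nat.pow_le_pow_right hp (by omega))
  induction l generalizing G with
  | zero =>
    have h1 := pow_dvd_modByMonic (radicalFactor_monic hp hn k c 0) (h 0 le_rfl)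
    rw [modByMonic_eq_self_iff (radicalFactor_monic hp hn k c 0) |>.mpr] at h1
    · exact (C_dvd_iff_dvd_coeff _ _ |>.mp h1 _).mul_left _
    · refine degree_lt_degree ?_
      rw [radicalFactor, natDegree_X_pow_sub_C]
      exact hG
  | succ l ih =>
    set f := radicalFactor p n' k c (l + 1) with hf
    have hfm : f.Monic := radicalFactor_monic hp hn k c (l + 1)
    have hfd : f.natDegree = n' * p ^ (k + (l + 1)) - n' * p ^ (k + l) :=
      natDegree_radicalFactor_succ hp hn k c l
    have h1 := pow_dvd_modByMonic hfm (h (l + 1) le_rfl)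
    have hmono := hN (show l ≤ l + 1 by omega)
    simp only at hmono
    by_cases hlt : G.natDegree < f.natDegree
    · rw [modByMonic_eq_self_iff hfm |>.mpr (degree_lt_degree hlt)] at h1
      exact (C_dvd_iff_dvd_coeff _ _ |>.mp h1 _).mul_left _
    · by_cases hG0 : G = 0
      · simp [hG0]
      set q := G /ₘ f with hq
      have hqd : q.natDegree = G.natDegree - f.natDegree := natDegree_divByMonic G hfm
      have hql : q.leadingCoeff = G.leadingCoeff := by
        refine leadingCoeff_divByMonic_of_monic hfm ?_
        rw [degree_eq_natDegree hfm.ne_zero, degree_eq_natDegree hG0]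
        exact_mod_cast not_lt.mp hlt
      have hq0 : q.leadingCoeff ≠ 0 := by rwa [hql, leadingCoeff_ne_zero]
      have hpq : (C (p : R) * q).natDegree = q.natDegree :=
        natDegree_C_mul_of_mul_ne_zero fun h0 => hq0 (mem_nonZeroDivisors_iff_left.mp hpR _ h0)
      have hplc : (C (p : R) * q).leadingCoeff = p * q.leadingCoeff := by
        rw [leadingCoeff, hpq, coeff_C_mul, leadingCoeff]
      have h2 := ih (C (p : R) * q) (by rw [hpq, hqd]; omega) fun i hi => by
        have h5 := dvd_sub (h i (by omega)) (map_dvd (AdjoinRoot.mk (radicalFactor p n' k c i)) h1)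
        rw [← map_sub, show G - G %ₘ f = f * q by rw [hq, modByMonic_eq_sub_mul_div]; ring,
          map_mul, hf, mk_radicalFactor_succ p n' k c hi, ← map_mul] at h5
        obtain ⟨c', hc'⟩ := (hc.pow (p ^ l * (p - 1))).exists_left_inv
        refine (h5.mul_left (AdjoinRoot.mk _ (C c'))).trans (dvd_of_eq ?_)
        rw [← map_mul, ← mul_assoc, ← C_mul, mul_left_comm, hc', mul_one]
      rw [hpq, hqd, hplc, hql, hfd] at h2
      rw [stepCount_succ hN l _ (by rw [← hfd]; exact not_lt.mp hlt), pow_succ, mul_assoc]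
      exact h2

end RadicalFactor

/-! ### Maximality at `p` of the orders attached to the factors -/

section Maximality

open Polynomial

theorem AdjoinRoot.isReduced_of_squarefree {k : Type*} [Field k] {g : k[X]} (hg : Squarefree g) :
    IsReduced (AdjoinRoot g) := by
  refine (Ideal.isRadical_iff_quotient_reduced _).mp ?_
  rw [← isRadical_iff_span_singleton]
  exact isRadical_iff_squarefree_or_zero.mpr (.inl hg)

theorem AdjoinRoot.of_mem_nonZeroDivisors {R : Type*} [CommRing R] {f : R[X]} (hf : f.Monic)
    {x : R} (hx : x ∈ nonZeroDivisors R) : AdjoinRoot.of f x ∈ nonZeroDivisors (AdjoinRoot f) := by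
  rw [mem_nonZeroDivisors_iff_right]
  intro z hz
  obtain ⟨g, rfl⟩ := AdjoinRoot.mk_surjective z
  rw [← AdjoinRoot.mk_C, ← map_mul, AdjoinRoot.mk_eq_zero, ← modByMonic_eq_zero_iff_dvd hf,
    mul_comm, ← smul_eq_C_mul, smul_modByMonic] at hz
  rw [AdjoinRoot.mk_eq_zero, ← modByMonic_eq_zero_iff_dvd hf]
  ext i
  have := congrArg (fun q => coeff q i) hz
  simp only [coeff_smul, smul_eq_mul, coeff_zero] at this
  rw [coeff_zero]
  exact mem_nonZeroDivisors_iff_left.mp hx _ this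

variable {R k : Type*} [CommRing R] [Field k] {red : R →+* k} {p : ℕ}

theorem C_dvd_of_map_eq_zero (hker : ∀ x, red x = 0 → (p : R) ∣ x) {g : R[X]}
    (hg : g.map red = 0) : C (p : R) ∣ g := by
  refine (C_dvd_iff_dvd_coeff _ _).mpr fun i => hker _ ?_
  rw [← coeff_map, hg, coeff_zero]

theorem exists_eq_add_of_map_dvd (hsurj : Function.Surjective red)
    (hker : ∀ x, red x = 0 → (p : R) ∣ x) {φ g : R[X]} (h : φ.map red ∣ g.map red) :
    ∃ u v, g = φ * u + C (p : R) * v := by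
  obtain ⟨h', hh⟩ := h
  obtain ⟨u, rfl⟩ := map_surjective red hsurj h'
  rw [← Polynomial.map_mul, ← sub_eq_zero, ← Polynomial.map_sub] at hh
  obtain ⟨v, hv⟩ := C_dvd_of_map_eq_zero hker hh
  exact ⟨u, v, by rw [← hv]; ring⟩

theorem adjoinRoot_map_mk {S : Type*} [CommRing S] (i : R →+* S) (f : R[X]) (q : S[X])
    (h : q ∣ f.map i) (g : R[X]) :
    AdjoinRoot.map i f q h (AdjoinRoot.mk f g) = AdjoinRoot.mk q (g.map i) := by
  rw [AdjoinRoot.map, AdjoinRoot.lift_mk, ← eval₂_map, ← AdjoinRoot.aeval_eq, aeval_def,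
    AdjoinRoot.algebraMap_eq]

theorem mem_span_of_adjoinRoot_map_eq_zero (hsurj : Function.Surjective red)
    (hker : ∀ x, red x = 0 → (p : R) ∣ x) {f φ : R[X]} (h : φ.map red ∣ f.map red)
    (z : AdjoinRoot f) (hz : AdjoinRoot.map red f (φ.map red) h z = 0) :
    z ∈ Ideal.span {AdjoinRoot.mk f φ, (p : AdjoinRoot f)} := by
  obtain ⟨g, rfl⟩ := AdjoinRoot.mk_surjective z
  rw [adjoinRoot_map_mk, AdjoinRoot.mk_eq_zero] at hz
  obtain ⟨u, v, rfl⟩ := exists_eq_add_of_map_dvd hsurj hker hz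
  refine Ideal.mem_span_pair.mpr ⟨AdjoinRoot.mk f u, AdjoinRoot.mk f v, ?_⟩
  simp [mul_comm]

/-- `A` is `p`-saturated: every element of `A[1/p]` that is integral over `A` lies in `A`. The
element `z / p ^ κ` is a root of the monic polynomial `P` exactly when `z` is a root of
`P.scaleRoots (p ^ κ)`. -/
def IsSaturatedAt (A : Type*) [CommRing A] (p : ℕ) : Prop :=
  ∀ (P : A[X]) (κ : ℕ) (z : A), P.Monic → (P.scaleRoots ((p : A) ^ κ)).eval z = 0 →
    (p : A) ^ κ ∣ z

theorem isSaturatedAt_adjoinRoot_of_squarefree (hp : (p : R) ∈ nonZeroDivisors R)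
    (h0 : red p = 0) (hsurj : Function.Surjective red) (hker : ∀ x, red x = 0 → (p : R) ∣ x)
    {f : R[X]} (hf : f.Monic) (hsq : Squarefree (f.map red)) : IsSaturatedAt (AdjoinRoot f) p := by
  intro P κ z hP hz
  have := AdjoinRoot.isReduced_of_squarefree hsq
  have hpA : (p : AdjoinRoot f) ∈ nonZeroDivisors (AdjoinRoot f) := by
    simpa using AdjoinRoot.of_mem_nonZeroDivisors hf hp
  -- here `p` itself plays the role of the uniformiser
  refine pow_dvd_of_scaleRoots_eval_eq_zero (φ := (p : AdjoinRoot f)) (F := 1) (e := 1) hpA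
    (by simp) (AdjoinRoot.map red f (f.map red) dvd_rfl) (fun z hz => ?_) ?_ (by simp) hP κ hz
  · have := mem_span_of_adjoinRoot_map_eq_zero hsurj hker dvd_rfl z hz
    rw [AdjoinRoot.mk_self, Ideal.mem_span_pair] at this
    obtain ⟨u, v, huv⟩ := this
    exact Ideal.mem_span_pair.mpr ⟨u, v - u, by rw [← huv]; ring⟩
  · rw [map_natCast, ← map_natCast (AdjoinRoot.of (f.map red)), ← map_natCast red, h0, map_zero]

/-- Dedekind's criterion for `R[X] / (f)` with `f = φ ^ e` modulo `p`: the order is `p`-saturated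
as soon as `φ` is squarefree modulo `p` and `f` is congruent modulo `φ` to a constant that is
divisible by `p` exactly once. -/
theorem isSaturatedAt_adjoinRoot (hp : (p : R) ∈ nonZeroDivisors R)
    (hsurj : Function.Surjective red) (hker : ∀ x, red x = 0 → (p : R) ∣ x) {f φ : R[X]}
    (hf : f.Monic) (hφ : φ.Monic) (hsq : Squarefree (φ.map red)) {e : ℕ} (he : 0 < e)
    (hfφ : f.map red = φ.map red ^ e) {V : R} (hV : φ ∣ f - C V) (hV0 : red V = 0)
    (hV1 : ¬ (p : R) ^ 2 ∣ V) : IsSaturatedAt (AdjoinRoot f) p := by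
  intro P κ z hP hz
  have := AdjoinRoot.isReduced_of_squarefree hsq
  have hpA : (p : AdjoinRoot f) ∈ nonZeroDivisors (AdjoinRoot f) := by
    simpa using AdjoinRoot.of_mem_nonZeroDivisors hf hp
  have hdvd : φ.map red ∣ f.map red := hfφ ▸ dvd_pow_self _ he.ne'
  obtain ⟨V', rfl⟩ := hker _ hV0
  have hV' : red V' ≠ 0 := fun h => hV1 (by
    rw [pow_two]; exact mul_dvd_mul_left _ (hker _ h))
  obtain ⟨F, hF⟩ : C (p : R) ∣ f - φ ^ e :=
    C_dvd_of_map_eq_zero hker (by rw [Polynomial.map_sub, hfφ, Polynomial.map_pow, sub_self])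
  have hFV : φ ∣ F - C V' := by
    rw [← AdjoinRoot.mk_eq_zero]
    have h1 : AdjoinRoot.mk φ (C (p : R) * (F - C V')) = 0 := by
      rw [AdjoinRoot.mk_eq_zero, mul_sub, ← hF, ← C_mul]
      have : f - φ ^ e - C (p * V') = (f - C (p * V')) - φ ^ e := by ring
      rw [this]
      exact dvd_sub hV (dvd_pow_self _ he.ne')
    rw [map_mul, mul_comm, AdjoinRoot.mk_C] at h1
    exact (mem_nonZeroDivisors_iff_right.mp (AdjoinRoot.of_mem_nonZeroDivisors hφ hp)) _ h1
  refine pow_dvd_of_scaleRoots_eval_eq_zero (φ := AdjoinRoot.mk f φ) (F := -AdjoinRoot.mk f F)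
    (e := e) hpA ?_ (AdjoinRoot.map red f (φ.map red) hdvd)
    (mem_span_of_adjoinRoot_map_eq_zero hsurj hker hdvd) ?_ ?_ hP κ hz
  · have h1 := congrArg (AdjoinRoot.mk f) hF
    rw [map_sub, AdjoinRoot.mk_self, map_mul, map_pow, map_natCast, map_natCast] at h1
    linear_combination -h1
  · rw [adjoinRoot_map_mk, AdjoinRoot.mk_self]
  · rw [map_neg, adjoinRoot_map_mk, IsUnit.neg_iff]
    have h1 : AdjoinRoot.mk (φ.map red) (F.map red) = AdjoinRoot.of _ (red V') := by
      rw [← AdjoinRoot.mk_C, AdjoinRoot.mk_eq_mk, ← Polynomial.map_C, ← Polynomial.map_sub]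
      exact Polynomial.map_dvd red hFV
    rw [h1]
    exact (IsUnit.mk0 _ hV').map _

/-- Every factor is a power of `φ = X ^ n' - c` modulo `p`, so Dedekind's criterion applies; the
constants to which the factors are congruent modulo `φ` are found by replacing `X ^ n'` by `c`. -/
theorem radicalFactor_isSaturatedAt [CharP k p] [Fact p.Prime]
    (hp : (p : R) ∈ nonZeroDivisors R)
    (hsurj : Function.Surjective red) (hker : ∀ x, red x = 0 → (p : R) ∣ x) {n' : ℕ}
    (hn : 0 < n') (hpn : ¬ p ∣ n') (κ m : ℕ) {c : R} (hc : IsUnit c) (hcp : red c ^ p = red c)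
    (h0 : κ = 0 ∨ ¬ (p : R) ^ 2 ∣ c ^ p ^ κ - c)
    (h1 : ∀ l < m, ¬ (p : R) ^ 2 ∣ ∑ t ∈ Finset.range p,
      (c ^ p ^ (κ + l)) ^ t * (c ^ p ^ l) ^ (p - 1 - t)) (i : ℕ) (hi : i ≤ m) :
    IsSaturatedAt (AdjoinRoot (radicalFactor p n' κ c i)) p := by
  have hp' : p.Prime := Fact.out
  have hfm := radicalFactor_monic hp'.pos hn κ c
  have hcp' : ∀ j, red c ^ p ^ j = red c := by
    intro j
    induction j with
    | zero => simp
    | succ j ih => rw [pow_succ, pow_mul, ih, hcp]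
  have hredp : red p = 0 := by rw [map_natCast, CharP.cast_eq_zero]
  set φ : R[X] := X ^ n' - C c with hφ
  have hφm : φ.Monic := monic_X_pow_sub_C _ hn.ne'
  have hφred : φ.map red = X ^ n' - C (red c) := by simp [hφ]
  have hsq : Squarefree (φ.map red) := by
    rw [hφred]
    exact (separable_X_pow_sub_C' p n' _ hpn (hc.map red).ne_zero).squarefree
  have hpow : ∀ l j, ((X ^ (n' * p ^ l) - C (c ^ p ^ j) : R[X])).map red =
      φ.map red ^ p ^ l := by
    intro l j
    rw [hφred, sub_pow_char_pow, ← C_pow, hcp', Polynomial.map_sub, Polynomial.map_pow, map_X,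
      map_C, map_pow, hcp', pow_mul]
  have hmkX : ∀ j, AdjoinRoot.mk φ (X ^ (n' * p ^ j)) = AdjoinRoot.mk φ (C (c ^ p ^ j)) := by
    intro j
    have : AdjoinRoot.mk φ (X ^ n') = AdjoinRoot.mk φ (C c) := AdjoinRoot.mk_eq_mk.mpr dvd_rfl
    rw [pow_mul, map_pow, this, ← map_pow, C_pow]
  cases i with
  | zero =>
    have hmap : (radicalFactor p n' κ c 0).map red = φ.map red ^ p ^ κ := by
      simpa [radicalFactor] using hpow κ 0
    rcases h0 with rfl | h0
    · refine isSaturatedAt_adjoinRoot_of_squarefree hp hredp hsurj hker (hfm 0) ?_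
      rw [hmap, pow_zero, pow_one]
      exact hsq
    · refine isSaturatedAt_adjoinRoot hp hsurj hker (hfm 0) hφm hsq (pow_pos hp'.pos κ) hmap
        (V := c ^ p ^ κ - c) ?_ ?_ h0
      · rw [← AdjoinRoot.mk_eq_mk, radicalFactor, map_sub, hmkX, ← map_sub, ← C_sub]
      · rw [map_sub, map_pow, hcp', sub_self]
  | succ l =>
    refine isSaturatedAt_adjoinRoot hp hsurj hker (hfm (l + 1)) hφm hsq
      (e := p ^ (κ + (l + 1)) - p ^ (κ + l)) ?_ ?_
      (V := ∑ t ∈ Finset.range p, (c ^ p ^ (κ + l)) ^ t * (c ^ p ^ l) ^ (p - 1 - t))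
      ?_ ?_ (h1 l (by omega))
    · exact Nat.sub_pos_of_lt (Nat.pow_lt_pow_right hp'.one_lt (by omega))
    · have h2 := congrArg (Polynomial.map red) (radicalFactor_succ_mul p n' κ c l)
      rw [Polynomial.map_mul, hpow, hpow] at h2
      refine mul_right_cancel₀ (pow_ne_zero (p ^ (κ + l)) (hφm.map red).ne_zero) ?_
      rw [h2, ← pow_add, Nat.sub_add_cancel]
      exact Nat.pow_le_pow_right hp'.pos (by omega)
    · rw [← AdjoinRoot.mk_eq_mk, radicalFactor]
      simp only [map_sum, map_mul, map_pow] at hmkX ⊢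
      rw [hmkX]
    · simp only [map_sum, map_mul, map_pow, hcp']
      rw [Finset.sum_congr rfl (g := fun _ => red c ^ (p - 1))]
      · simp
      · intro t ht
        rw [Finset.mem_range] at ht
        rw [← pow_add]
        congr 1
        omega

end Maximality

/-! ### Integral equations under a change of ring -/

section Transfer

open Polynomial

theorem minpoly_eq_of_irreducible {K : Type*} [Field K] [CharZero K] {f : ℤ[X]} {θ : K}
    (hfm : f.Monic) (hf : Irreducible f) (hθ : aeval θ f = 0) : minpoly ℤ θ = f := by
  have hint : IsIntegral ℤ θ := ⟨f, hfm, hθ⟩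
  refine eq_of_monic_of_associated (minpoly.monic hint) hfm ?_
  exact (hf.dvd_iff.mp (minpoly.isIntegrallyClosed_dvd hint hθ)).resolve_left
    (minpoly.not_isUnit ℤ θ) |>.symm

/-- The integral equation of an element `H(θ) / b` of a field only depends on `H` and on the
minimal polynomial `f` of `θ`, so it persists in every ring containing a root `t` of `f`. -/
theorem exists_monic_scaleRoots_eval_eq_zero {K A : Type*} [Field K] [CharZero K] [CommRing A]
    {f H : ℤ[X]} {θ y : K} (hfm : f.Monic) (hf : Irreducible f) (hθ : aeval θ f = 0)
    (hy : IsIntegral ℤ y) {b : ℤ} (h : (b : K) * y = aeval θ H) {t : A}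
    (ht : f.eval₂ (Int.castRingHom A) t = 0) :
    ∃ P : A[X], P.Monic ∧ (P.scaleRoots (b : A)).eval (H.eval₂ (Int.castRingHom A) t) = 0 := by
  obtain ⟨P, hPm, hP⟩ := hy
  have hmin : minpoly ℤ θ = f := minpoly_eq_of_irreducible hfm hf hθ
  have h1 : aeval θ ((P.scaleRoots b).comp H) = 0 := by
    rw [aeval_comp, ← h, aeval_def]
    have := scaleRoots_eval₂_mul (p := P) (algebraMap ℤ K) y b
    rw [hP, mul_zero] at this
    exact this
  have h2 : f ∣ (P.scaleRoots b).comp H := by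
    rw [← hmin]
    exact minpoly.isIntegrallyClosed_dvd ⟨f, hfm, hθ⟩ h1
  refine ⟨P.map (Int.castRingHom A), hPm.map _, ?_⟩
  rcases subsingleton_or_nontrivial A with _ | _
  · exact Subsingleton.elim _ _
  have h3 : ((P.scaleRoots b).comp H).eval₂ (Int.castRingHom A) t = 0 := by
    obtain ⟨g, hg⟩ := h2
    rw [hg, eval₂_mul, ht, zero_mul]
  rwa [eval₂_comp, ← eval_map, map_scaleRoots _ _ _ (by simp [hPm.leadingCoeff]),
    eq_intCast] at h3

end Transfer

/-! ### The index at a prime not dividing `a` -/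

section NotDvd

open Polynomial NumberField

/-- Divisibility of an integer by `p ^ κ` can be tested in `R`, since `p` is not invertible there. -/
theorem pow_dvd_of_pow_dvd_intCast {R k : Type*} [CommRing R] [Field k] (red : R →+* k) {p : ℕ}
    [CharP k p] (hp : (p : R) ∈ nonZeroDivisors R) {κ : ℕ} {x : ℤ}
    (h : (p : R) ^ κ ∣ (x : R)) : (p : ℤ) ^ κ ∣ x := by
  induction κ generalizing x with
  | zero => simp
  | succ κ ih =>
    have h1 : (p : ℤ) ∣ x := by
      obtain ⟨w, hw⟩ := h
      have := congrArg red hw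
      rw [pow_succ, map_intCast, map_mul, map_mul, map_natCast, CharP.cast_eq_zero k p, mul_zero,
        zero_mul] at this
      exact (CharP.intCast_eq_zero_iff k p x).mp this
    obtain ⟨x', rfl⟩ := h1
    rw [pow_succ']
    refine mul_dvd_mul_left _ (ih ?_)
    obtain ⟨w, hw⟩ := h
    refine ⟨w, ?_⟩
    have h2 : (p : R) * (x' - p ^ κ * w) = 0 := by
      push_cast at hw
      rw [mul_sub, hw]; ring
    exact sub_eq_zero.mp (mem_nonZeroDivisors_iff_left.mp hp _ h2)

theorem prime_pow_dvd_choose_mul_pow {p : ℕ} (hp : p.Prime) {j i : ℕ} (hi : i ≠ 0)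
    (hij : i ≤ p ^ j) : p ^ j ∣ (p ^ j).choose i * p ^ (i - 1) := by
  have h1 := hp.emultiplicity_choose_prime_pow_add_emultiplicity hij hi
  have h2 : emultiplicity p i ≤ emultiplicity p (p ^ (i - 1)) := by
    have h3 : emultiplicity p i < (i : ℕ) := emultiplicity_lt_iff_not_dvd.mpr fun h =>
      absurd (Nat.le_of_dvd (Nat.pos_of_ne_zero hi) h) (not_le.mpr (Nat.lt_pow_self hp.one_lt))
    rw [hp.emultiplicity_pow_self]
    refine Order.le_of_lt_add_one (h3.trans_eq ?_)
    exact_mod_cast (Nat.sub_add_cancel (Nat.pos_of_ne_zero hi)).symm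
  refine pow_dvd_of_le_emultiplicity ?_
  rw [emultiplicity_mul hp.prime, ← h1]
  gcongr

/-- If `y ^ q = a` with `q = p ^ j` and `a ≡ a ^ q` modulo `p q`, then
`(y ^ (q - 1) + a y ^ (q - 2) + ⋯ + a ^ (q - 1)) / q` is integral. Calling it `E` and writing
`a - a ^ q = q d`, one has `(y - a) E = d`, so `(a E + d) ^ q = a E ^ q`; after division by `q d`
this is an integral equation for `E`. -/
theorem isIntegral_geomSum_div {K : Type*} [Field K] [CharZero K] {p : ℕ} (hp : p.Prime) (j : ℕ)
    {a : ℤ} {y : K} (hy : y ^ p ^ j = a) (ha : (p : ℤ) ^ (j + 1) ∣ a - a ^ p ^ j) :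
    IsIntegral ℤ ((∑ t ∈ Finset.range (p ^ j), y ^ t * (a : K) ^ (p ^ j - 1 - t)) / (p ^ j : ℕ)) := by
  set q := p ^ j with hq
  have hq0 : (q : K) ≠ 0 := by exact_mod_cast (pow_pos hp.pos j).ne'
  obtain ⟨d', hd'⟩ := ha
  set d : ℤ := p * d' with hd
  have had : a - a ^ q = q * d := by rw [hd', hd, hq]; push_cast; ring
  set E := (∑ t ∈ Finset.range q, y ^ t * (a : K) ^ (q - 1 - t)) / q with hE
  have hEd : E * (y - a) = d := by
    rw [hE, div_mul_eq_mul_div, (Commute.all _ _).geom_sum₂_mul, hy, div_eq_iff hq0]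
    exact_mod_cast had.trans (mul_comm _ _)
  by_cases hd0 : d = 0
  · rw [hd0, Int.cast_zero, mul_eq_zero, sub_eq_zero] at hEd
    rcases hEd with h | h
    · rw [h]; exact isIntegral_zero
    · have : E = ((a ^ (q - 1) : ℤ) : K) := by
        rw [hE, h, div_eq_iff hq0, Finset.sum_congr rfl (g := fun _ => (a : K) ^ (q - 1))]
        · simp [mul_comm]
        · intro t ht
          rw [Finset.mem_range] at ht
          rw [← pow_add]; congr 1; omega
      rw [this]
      exact isIntegral_algebraMap (R := ℤ) (x := a ^ (q - 1))
  have hdK : (d : K) ≠ 0 := by exact_mod_cast hd0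
  -- the coefficients of the integral equation
  have hb : ∀ i, ∃ b : ℤ, i < q → (q.choose (i + 1) : ℤ) * d ^ i = q * b := by
    intro i
    by_cases hi : i < q
    · have h1 := prime_pow_dvd_choose_mul_pow hp (j := j) (i := i + 1) (by omega) hi
      obtain ⟨w, hw⟩ := h1
      rw [Nat.add_sub_cancel] at hw
      refine ⟨w * d' ^ i, fun _ => ?_⟩
      rw [hd, mul_pow, ← mul_assoc, ← mul_assoc]
      congr 1
      exact_mod_cast hw
    · exact ⟨0, fun h => absurd h hi⟩
  choose b hb using hb
  let P : ℤ[X] := X ^ q - ∑ i ∈ Finset.range q,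
    Polynomial.C (b i * a ^ (q - 1 - i)) * X ^ (q - 1 - i)
  have hq1 : 0 < q := pow_pos hp.pos j
  refine ⟨P, ?_, ?_⟩
  · refine monic_X_pow_sub ((degree_sum_le _ _).trans_lt ?_)
    rw [Finset.sup_lt_iff (by exact_mod_cast WithBot.bot_lt_coe q)]
    intro i hi
    refine (degree_C_mul_X_pow_le _ _).trans_lt ?_
    rw [Finset.mem_range] at hi
    exact_mod_cast (show q - 1 - i < q by omega)
  · have h1 : (a * E + d) ^ q = a * E ^ q := by
      have : a * E + d = y * E := by rw [← hEd]; ring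
      rw [this, mul_pow, hy]
    rw [add_comm, add_pow, Finset.sum_range_succ'] at h1
    have h2 : ∑ i ∈ Finset.range q, (d : K) ^ (i + 1) * (a * E) ^ (q - (i + 1)) *
        (q.choose (i + 1) : K) =
        q * d * ∑ i ∈ Finset.range q, (b i * a ^ (q - 1 - i) : K) * E ^ (q - 1 - i) := by
      rw [Finset.mul_sum]
      refine Finset.sum_congr rfl fun i hi => ?_
      have h3 := hb i (Finset.mem_range.mp hi)
      have h4 : (q.choose (i + 1) : K) * d ^ i = q * b i := by exact_mod_cast h3
      rw [show q - (i + 1) = q - 1 - i by omega, mul_pow, pow_succ]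
      linear_combination d * a ^ (q - 1 - i) * E ^ (q - 1 - i) * h4
    rw [h2] at h1
    have h5 : (q * d : K) * (E ^ q -
        ∑ i ∈ Finset.range q, (b i * a ^ (q - 1 - i) : K) * E ^ (q - 1 - i)) = 0 := by
      have h6 : (a : K) - a ^ q = q * d := by exact_mod_cast had
      simp only [pow_zero, Nat.sub_zero, mul_pow, Nat.choose_zero_right, Nat.cast_one, mul_one,
        one_mul] at h1
      linear_combination -h1 - E ^ q * h6
    have h7 := (mul_eq_zero.mp h5).resolve_left (mul_ne_zero hq0 hdK)
    rw [← aeval_def]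
    simpa [P] using h7

/-- The `p`-part of the index of `ℤ[θ]` when `p ∤ a`, in terms of a `p ^ m`-th root `c` of `a` in an
unramified extension `R` of `ℤ_p` (with residue field `k`). The hypotheses `h0` and `h1` are
Dedekind's criterion for the factors of `X ^ n - c ^ p ^ m` over `R`, and `ha` makes
`∑ t, Y ^ t * a ^ (p ^ j - 1 - t)`, with `Y = θ ^ (n / p ^ j)`, divisible by `p ^ j` in `𝓞 K`. -/
theorem discr_pow_eq_of_root {K : Type*} [Field K] [NumberField K] {n : ℕ} {a : ℤ}
    (hirr : Irreducible (X ^ n - C a : ℤ[X])) {θ : 𝓞 K} (hroot : aeval θ (X ^ n - C a : ℤ[X]) = 0)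
    (hfin : Module.finrank ℚ K = n) {R k : Type*} [CommRing R] [CharZero R] [Field k] {p : ℕ}
    [Fact p.Prime] [CharP k p] {red : R →+* k} (hp : (p : R) ∈ nonZeroDivisors R)
    (hsurj : Function.Surjective red) (hker : ∀ x, red x = 0 → (p : R) ∣ x) {n' κ m : ℕ}
    (hn : n = n' * p ^ (κ + m)) (hn' : 0 < n') (hpn : ¬ p ∣ n') {c : R} (hc : IsUnit c)
    (hca : c ^ p ^ m = a) (hcp : red c ^ p = red c)
    (h0 : κ = 0 ∨ ¬ (p : R) ^ 2 ∣ c ^ p ^ κ - c)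
    (h1 : ∀ l < m, ¬ (p : R) ^ 2 ∣ ∑ t ∈ Finset.range p,
      (c ^ p ^ (κ + l)) ^ t * (c ^ p ^ l) ^ (p - 1 - t))
    (ha : ∀ j ≤ m, (p : ℤ) ^ (j + 1) ∣ a - a ^ p ^ j) :
    ∃ D : ℤ, ¬ (p : ℤ) ∣ D ∧ Algebra.discr ℤ (fun i : Fin n => θ ^ (i : ℕ)) =
      (p : ℤ) ^ (2 * ∑ j ∈ Finset.Icc 1 m, n' * p ^ (κ + m - j)) * D ^ 2 * discr K := by
  have hp' : p.Prime := Fact.out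
  have hn0 : 0 < n := hn ▸ Nat.mul_pos hn' (pow_pos hp'.pos _)
  set N : ℕ → ℕ := fun i => n' * p ^ (κ + i) with hN
  have hNmono : Monotone N := fun i j hij =>
    Nat.mul_le_mul_left _ (Nat.pow_le_pow_right hp'.pos (by omega))
  have hNm : N m = n := hn.symm
  have hsum : ∑ j ∈ Finset.Icc 1 m, n' * p ^ (κ + m - j) =
      ∑ d ∈ Finset.range n, stepCount N m d := by
    rw [← hNm, sum_stepCount hNmono]
    refine Finset.sum_congr rfl fun j hj => ?_
    rw [Finset.mem_Icc] at hj
    rw [hN, Nat.add_sub_assoc hj.2]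
  have hθ : θ ^ n = (a : 𝓞 K) := by
    simpa [sub_eq_zero] using hroot
  rw [hsum]
  let S : ℕ → ℤ[X] := fun j => ∑ t ∈ Finset.range (p ^ j),
    (X ^ N (m - j)) ^ t * (C a) ^ (p ^ j - 1 - t)
  have hNj : ∀ j ≤ m, N (m - j) * p ^ j = n := fun j hj => by
    rw [hn, hN, mul_assoc, ← pow_add]; congr 2; omega
  have hS : ∀ j ≤ m, S j * (X ^ N (m - j) - C a) = X ^ n - C (a ^ p ^ j) := fun j hj => by
    rw [(Commute.all _ _).geom_sum₂_mul, ← pow_mul, hNj j hj, C_pow]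
  have hNpos : ∀ i, N i ≠ 0 := fun i => (Nat.mul_pos hn' (pow_pos hp'.pos _)).ne'
  have hSm : ∀ j ≤ m, (S j).Monic := fun j hj =>
    Monic.of_mul_monic_right (monic_X_pow_sub_C a (hNpos _))
      (hS j hj ▸ monic_X_pow_sub_C _ hn0.ne')
  have hSd : ∀ j ≤ m, (S j).natDegree = n - N (m - j) := fun j hj => by
    have := congrArg natDegree (hS j hj)
    rw [(hSm j hj).natDegree_mul (monic_X_pow_sub_C _ (hNpos _)), natDegree_X_pow_sub_C,
      natDegree_X_pow_sub_C] at this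
    omega
  refine discr_pow_eq_of_leadingCoeff hfin θ hp' (stepCount N m)
    (fun d => S (stepCount N m d) * X ^ (d - (n - N (m - stepCount N m d)))) ?_ ?_
  · intro d hd
    set j := stepCount N m d with hj
    have hjm : j ≤ m := stepCount_le N m d
    have hle : n - N (m - j) ≤ d := by
      rcases Nat.eq_zero_or_pos j with h | h
      · rw [h, Nat.sub_zero, hNm]; omega
      · have := le_of_stepCount_eq hNmono hj.symm h
        rwa [hNm] at this
    refine ⟨(hSm j hjm).mul (monic_X_pow _), ?_, ?_⟩
    · rw [(hSm j hjm).natDegree_mul (monic_X_pow _), hSd j hjm, natDegree_X_pow]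
      omega
    · have hy : ((θ : K) ^ N (m - j)) ^ p ^ j = a := by
        rw [← pow_mul, hNj j hjm]
        simpa using congrArg (algebraMap (𝓞 K) K) hθ
      obtain ⟨w, hw⟩ := (IsIntegralClosure.isIntegral_iff (A := 𝓞 K)).mp
        (isIntegral_geomSum_div hp' j hy (ha j hjm))
      refine ⟨w * θ ^ (d - (n - N (m - j))), ?_⟩
      apply RingOfIntegers.ext
      have hpj : ((p ^ j : ℕ) : K) ≠ 0 := by exact_mod_cast (pow_pos hp'.pos j).ne'
      simp only [S, map_mul, map_sum, map_pow, aeval_X, eq_intCast, map_natCast,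
        map_intCast]
      rw [← mul_assoc]
      congr 1
      rw [← Nat.cast_pow]
      rw [hw]
      exact mul_div_cancel₀ _ hpj
  · intro H hH κ' y hy
    have hnz := pow_dvd_leadingCoeff_of_forall_radicalFactor hp'.pos hn' κ hc hp κ' m
      (H.map (Int.castRingHom R)) (by
        rw [natDegree_map_eq_of_injective (RingHom.injective_int _)]
        exact hH.trans_eq hn) ?_
    · rw [natDegree_map_eq_of_injective (RingHom.injective_int _),
        leadingCoeff_map_of_injective (RingHom.injective_int _), eq_intCast] at hnz
      refine pow_dvd_of_pow_dvd_intCast red hp ?_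
      exact_mod_cast hnz
    · intro i hi
      have ht : (X ^ n - C a : ℤ[X]).eval₂ (Int.castRingHom _)
          (AdjoinRoot.root (radicalFactor p n' κ c i)) = 0 := by
        have h2 := (AdjoinRoot.mk_eq_zero (f := radicalFactor p n' κ c i)).mpr
          (radicalFactor_dvd p n' κ c hi)
        rw [← hn, hca] at h2
        rw [eval₂_sub, eval₂_pow, eval₂_X, eval₂_C]
        simpa using h2
      obtain ⟨P, hP, hP'⟩ := exists_monic_scaleRoots_eval_eq_zero (y := (y : K)) (θ := (θ : K))
        (b := (p : ℤ) ^ κ') (H := H) (monic_X_pow_sub_C a hn0.ne') hirr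
        (by
          have := congrArg (algebraMap (𝓞 K) K) hroot
          rwa [map_zero, ← aeval_algebraMap_apply] at this)
        (RingOfIntegers.isIntegral_coe y)
        (by
          have := congrArg (algebraMap (𝓞 K) K) hy
          rw [← aeval_algebraMap_apply] at this
          rw [← this]
          simp) ht
      have h3 := radicalFactor_isSaturatedAt hp hsurj hker hn' hpn κ m hc hcp h0 h1 i hi P κ' _ hP
        (by simpa using hP')
      have h4 : H.eval₂ (Int.castRingHom _) (AdjoinRoot.root (radicalFactor p n' κ c i)) =
          AdjoinRoot.mk _ (H.map (Int.castRingHom R)) := by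
        rw [← AdjoinRoot.aeval_eq, aeval_def, eval₂_map, AdjoinRoot.algebraMap_eq]
        congr 1
      rw [h4] at h3
      simpa using h3

end NotDvd

/-! ### Roots of integers in unramified extensions of `ℤ_p` -/

section Roots

open Polynomial

theorem pow_add_dvd_pow_sub_pow {R : Type*} [CommRing R] {p : ℕ} {x y : R} {i : ℕ}
    (h : (p : R) ^ (i + 1) ∣ x - y) (k : ℕ) :
    (p : R) ^ (i + 1 + k) ∣ x ^ p ^ k - y ^ p ^ k := by
  induction k with
  | zero => simpa using h
  | succ k ih =>
    rw [pow_succ p k, pow_mul, pow_mul, ← (Commute.all _ _).geom_sum₂_mul, ← add_assoc, pow_succ']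
    refine mul_dvd_mul (dvd_geom_sum₂_self ?_) ih
    exact (dvd_pow_self _ (by omega)).trans ih

theorem PadicInt.natCast_mem_nonZeroDivisors (p : ℕ) [Fact p.Prime] :
    (p : ℤ_[p]) ∈ nonZeroDivisors ℤ_[p] :=
  mem_nonZeroDivisors_of_ne_zero (PadicInt.prime_p).ne_zero

theorem PadicInt.dvd_of_toZMod_eq_zero {p : ℕ} [Fact p.Prime] (x : ℤ_[p])
    (h : PadicInt.toZMod x = 0) : (p : ℤ_[p]) ∣ x := by
  rw [← RingHom.mem_ker, PadicInt.ker_toZMod, PadicInt.maximalIdeal_eq_span_p,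
    Ideal.mem_span_singleton] at h
  exact h

theorem PadicInt.toZMod_surjective (p : ℕ) [Fact p.Prime] :
    Function.Surjective (PadicInt.toZMod : ℤ_[p] →+* ZMod p) :=
  ZMod.ringHom_surjective _

theorem PadicInt.isUnit_of_not_dvd {p : ℕ} [Fact p.Prime] {x : ℤ_[p]} (h : ¬ (p : ℤ_[p]) ∣ x) :
    IsUnit x := by
  by_contra hx
  exact h ((PadicInt.norm_lt_one_iff_dvd x).mp (PadicInt.not_isUnit_iff.mp hx))

theorem PadicInt.isUnit_one_add_mul {p : ℕ} [Fact p.Prime] (x : ℤ_[p]) :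
    IsUnit (1 + (p : ℤ_[p]) * x) :=
  PadicInt.isUnit_of_not_dvd fun h => PadicInt.prime_p.not_isUnit
    (isUnit_of_dvd_one ((dvd_add_left (dvd_mul_right _ x)).mp h))

/-- Hensel's lemma for `X ^ p - u`, whose derivative has valuation `1` at a unit. -/
theorem PadicInt.exists_pow_eq_of_dvd {p : ℕ} [Fact p.Prime] {u z : ℤ_[p]} (hz : IsUnit z)
    (h : (p : ℤ_[p]) ^ 3 ∣ z ^ p - u) : ∃ w : ℤ_[p], w ^ p = u ∧ (p : ℤ_[p]) ^ 2 ∣ w - z := by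
  have hp : p.Prime := Fact.out
  have hF : aeval z (X ^ p - C u : ℤ_[p][X]) = z ^ p - u := by simp
  have hF' : aeval z (derivative (X ^ p - C u : ℤ_[p][X])) = p * z ^ (p - 1) := by
    simp [derivative_X_pow]
  have hn' : ‖aeval z (derivative (X ^ p - C u : ℤ_[p][X]))‖ = (p : ℝ) ^ (-1 : ℤ) := by
    rw [hF', norm_mul, norm_pow, PadicInt.isUnit_iff.mp hz, one_pow, mul_one, PadicInt.norm_p,
      zpow_neg_one]
  have hn : ‖aeval z (X ^ p - C u : ℤ_[p][X])‖ <
      ‖aeval z (derivative (X ^ p - C u : ℤ_[p][X]))‖ ^ 2 := by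
    rw [hn', hF]
    refine ((PadicInt.norm_le_pow_iff_mem_span_pow _ 3).mpr
      (Ideal.mem_span_singleton.mpr h)).trans_lt ?_
    rw [← zpow_natCast, ← zpow_mul]
    exact zpow_lt_zpow_right₀ (by exact_mod_cast hp.one_lt) (by norm_num)
  obtain ⟨w, hw, hwz, -⟩ := hensels_lemma hn
  refine ⟨w, by simpa [sub_eq_zero] using hw, ?_⟩
  rw [hn'] at hwz
  rw [← Ideal.mem_span_singleton, ← PadicInt.norm_le_pow_iff_mem_span_pow]
  simpa using (PadicInt.norm_lt_pow_iff_norm_le_pow_sub_one _ _).mp hwz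

theorem PadicInt.exists_pow_eq_of_odd {p : ℕ} [Fact p.Prime] (hodd : Odd p) {m : ℕ} {u : ℤ_[p]}
    (hu : IsUnit u) (h : (p : ℤ_[p]) ^ (m + 2) ∣ u ^ (p - 1) - 1) :
    ∃ w : ℤ_[p], IsUnit w ∧ w ^ p = u ∧ (p : ℤ_[p]) ^ (m + 1) ∣ w ^ (p - 1) - 1 := by
  have hp : p.Prime := Fact.out
  obtain ⟨t, ht⟩ : (p : ℤ_[p]) ^ 2 ∣ u ^ (p - 1) - 1 := (pow_dvd_pow _ (by omega)).trans h
  have hpnu : ¬ IsUnit (p : ℤ_[p]) := PadicInt.prime_p.not_isUnit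
  -- `u (1 - p t)` is a `p`-th root of `u` modulo `p ^ 3`
  obtain ⟨s, hs⟩ := odd_sq_dvd_geom_sum₂_sub (R := ℤ_[p]) (1 : ℤ_[p]) (-t) hodd
  have hgeom := (Commute.all (1 + (p : ℤ_[p]) * -t) 1).geom_sum₂_mul p
  have hz : (p : ℤ_[p]) ^ 3 ∣ (u * (1 + p * -t)) ^ p - u := by
    have h1 : u ^ p = u * (1 + p ^ 2 * t) := by
      rw [← ht, show u ^ p = u * u ^ (p - 1) by rw [← pow_succ', Nat.sub_add_cancel hp.one_le]]
      ring
    have h2 : (1 + (p : ℤ_[p]) * -t) ^ p = 1 + (p ^ 2 * s + p) * (p * -t) := by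
      rw [one_pow, mul_one] at hs
      rw [one_pow] at hgeom
      linear_combination -hgeom + (p * -t) * hs
    rw [mul_pow, h1, h2]
    exact ⟨u * (-s * t - p * t ^ 2 - p ^ 2 * s * t ^ 2), by ring⟩
  have hzu : IsUnit (u * (1 + (p : ℤ_[p]) * -t)) := hu.mul (PadicInt.isUnit_one_add_mul _)
  obtain ⟨w, hw, -⟩ := PadicInt.exists_pow_eq_of_dvd hzu hz
  have hwu : IsUnit w := by
    rw [← hw] at hu
    exact (isUnit_pow_iff hp.ne_zero).mp hu
  refine ⟨w, hwu, hw, ?_⟩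
  have h1 : (p : ℤ_[p]) ∣ w ^ (p - 1) - 1 := by
    apply PadicInt.dvd_of_toZMod_eq_zero
    rw [map_sub, map_pow, ZMod.pow_card_sub_one_eq_one (hwu.map _).ne_zero, map_one, sub_self]
  have h2 := emultiplicity_pow_prime_sub_pow_prime PadicInt.prime_p hodd h1
    (fun hd => hpnu (isUnit_of_dvd_unit hd (hwu.pow _)))
  rw [← pow_mul, mul_comm, pow_mul, hw, one_pow] at h2
  refine pow_dvd_of_le_emultiplicity ?_
  have h3 := le_emultiplicity_of_pow_dvd h
  rw [h2] at h3
  have : ((m + 1 : ℕ) : ℕ∞) + 1 ≤ emultiplicity (p : ℤ_[p]) (w ^ (p - 1) - 1) + 1 := by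
    exact_mod_cast h3
  exact (ENat.add_le_add_iff_right (by simp)).mp this

theorem PadicInt.exists_pow_pow_eq_of_odd {p : ℕ} [Fact p.Prime] (hodd : Odd p) (m : ℕ)
    {u : ℤ_[p]} (hu : IsUnit u) (h : (p : ℤ_[p]) ^ (m + 1) ∣ u ^ (p - 1) - 1) :
    ∃ c : ℤ_[p], IsUnit c ∧ c ^ p ^ m = u := by
  induction m generalizing u with
  | zero => exact ⟨u, hu, by simp⟩
  | succ m ih =>
    obtain ⟨w, hwu, hw, hw'⟩ := PadicInt.exists_pow_eq_of_odd hodd hu h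
    obtain ⟨c, hc, hcw⟩ := ih hwu hw'
    exact ⟨c, hc, by rw [pow_succ, pow_mul, hcw, hw]⟩

theorem PadicInt.exists_pow_two_pow_eq (m : ℕ) {u : ℤ_[2]} (h : (2 : ℤ_[2]) ^ (m + 2) ∣ u - 1) :
    ∃ c : ℤ_[2], c ^ 2 ^ m = u ∧ (4 : ℤ_[2]) ∣ c - 1 := by
  induction m generalizing u with
  | zero => exact ⟨u, by simp, by norm_num at h; exact h⟩
  | succ m ih =>
    obtain ⟨w, hw, h4⟩ := PadicInt.exists_pow_eq_of_dvd (p := 2) (u := u) isUnit_one (by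
      rw [one_pow, ← dvd_neg, neg_sub]
      exact (pow_dvd_pow _ (by omega)).trans h)
    obtain ⟨v, hv⟩ := h4
    have hw2 : (2 : ℤ_[2]) ^ (m + 2) ∣ w - 1 := by
      have h1 : u - 1 = 2 * (1 + 2 * v) * (w - 1) := by
        rw [← hw]; push_cast at hv ⊢; linear_combination (w - 1) * hv
      have hunit : IsUnit (1 + 2 * v : ℤ_[2]) := by
        exact_mod_cast PadicInt.isUnit_one_add_mul (p := 2) v
      obtain ⟨i, hi⟩ := hunit.exists_left_inv
      obtain ⟨q, hq⟩ := h
      refine ⟨i * q, mul_left_cancel₀ (two_ne_zero (α := ℤ_[2])) ?_⟩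
      linear_combination i * (hq - h1) - 2 * (w - 1) * hi
    obtain ⟨c, hc, hc4⟩ := ih hw2
    exact ⟨c, by rw [pow_succ, pow_mul, hc, hw], hc4⟩

end Roots

/-! ### The quadratic unramified extension of `ℤ_2` -/

section UnramifiedQuadratic

open QuadraticAlgebra

/-- The ring of integers `ℤ_2[ω]`, `ω ^ 2 + ω + 1 = 0`, of the unramified quadratic extension
of `ℚ_2`. -/
abbrev UnramifiedQuadratic : Type := QuadraticAlgebra ℤ_[2] (-1) (-1)

/-- The field with four elements, as the residue field of `ℤ_2[ω]`. -/
abbrev FourElementField : Type := QuadraticAlgebra (ZMod 2) (-1) (-1)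

instance : Fact (∀ r : ZMod 2, r ^ 2 ≠ -1 + -1 * r) := ⟨by decide⟩

instance : CharP FourElementField 2 :=
  charP_of_injective_algebraMap (R := ZMod 2) (algebraMap_injective) 2

instance : CharZero UnramifiedQuadratic :=
  charZero_of_injective_algebraMap (R := ℤ_[2]) (algebraMap_injective)

/-- Reduction modulo `2`. -/
noncomputable def unramifiedReduction : UnramifiedQuadratic →+* FourElementField where
  toFun z := ⟨PadicInt.toZMod z.re, PadicInt.toZMod z.im⟩
  map_one' := by ext <;> simp
  map_zero' := by ext <;> simp
  map_mul' x y := by ext <;> simp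
  map_add' x y := by ext <;> simp

theorem unramifiedReduction_surjective : Function.Surjective unramifiedReduction := by
  intro z
  obtain ⟨x, hx⟩ := PadicInt.toZMod_surjective 2 z.re
  obtain ⟨y, hy⟩ := PadicInt.toZMod_surjective 2 z.im
  exact ⟨⟨x, y⟩, by ext <;> simp [unramifiedReduction, hx, hy]⟩

theorem dvd_of_unramifiedReduction_eq_zero (z : UnramifiedQuadratic)
    (h : unramifiedReduction z = 0) : ((2 : ℕ) : UnramifiedQuadratic) ∣ z := by
  have h1 : PadicInt.toZMod z.re = 0 := congrArg QuadraticAlgebra.re h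
  have h2 : PadicInt.toZMod z.im = 0 := congrArg QuadraticAlgebra.im h
  obtain ⟨x, hx⟩ := PadicInt.dvd_of_toZMod_eq_zero _ h1
  obtain ⟨y, hy⟩ := PadicInt.dvd_of_toZMod_eq_zero _ h2
  exact ⟨⟨x, y⟩, by ext <;> simp [hx, hy]⟩

theorem two_mem_nonZeroDivisors_unramifiedQuadratic :
    ((2 : ℕ) : UnramifiedQuadratic) ∈ nonZeroDivisors UnramifiedQuadratic := by
  have := algebraMap_mem_nonZeroDivisors_iff (a := (-1 : ℤ_[2])) (b := -1) |>.mpr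
    (PadicInt.natCast_mem_nonZeroDivisors 2)
  rwa [map_natCast] at this

/-- An element `u ≡ 5` modulo `8` of `ℤ_2` has a square root `√-3 * w` in `ℤ_2[ω]`, where
`√-3 = 1 + 2 ω` and `w` is a unit. -/
theorem exists_sq_eq_of_mod_eight {u : ℤ_[2]} (h4 : (4 : ℤ_[2]) ∣ u - 1)
    (h8 : ¬ (8 : ℤ_[2]) ∣ u - 1) :
    ∃ w : ℤ_[2], IsUnit w ∧ (⟨w, 2 * w⟩ : UnramifiedQuadratic) ^ 2 =
      algebraMap ℤ_[2] UnramifiedQuadratic u := by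
  obtain ⟨v, hv⟩ := h4
  have hv2 : ¬ ((2 : ℕ) : ℤ_[2]) ∣ v := by
    rintro ⟨x, rfl⟩
    exact h8 ⟨x, by rw [hv]; push_cast; ring⟩
  obtain ⟨x, hx⟩ : ((2 : ℕ) : ℤ_[2]) ∣ v - 1 := by
    apply PadicInt.dvd_of_toZMod_eq_zero
    have h1 : PadicInt.toZMod v ≠ 0 := fun h => hv2 (PadicInt.dvd_of_toZMod_eq_zero _ h)
    have h2 : ∀ y : ZMod 2, y ≠ 0 → y - 1 = 0 := by decide
    rw [map_sub, map_one]
    exact h2 _ h1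
  have h3 : IsUnit (3 : ℤ_[2]) := by
    have := PadicInt.isUnit_one_add_mul (p := 2) 1
    norm_num at this
    exact this
  obtain ⟨i, hi⟩ := h3.exists_left_inv
  obtain ⟨g, hg, -⟩ := PadicInt.exists_pow_eq_of_dvd (p := 2) (u := -3 * u) (z := 1) isUnit_one
    ⟨2 + 3 * x, by push_cast at hx ⊢; linear_combination 3 * hv + 12 * hx⟩
  have hsq : (i * g) ^ 2 * -3 = u := by
    rw [mul_pow, hg]
    linear_combination u * (3 * i + 1) * hi
  have hu : IsUnit u := by
    have := PadicInt.isUnit_one_add_mul (p := 2) (2 * v)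
    rwa [show 1 + ((2 : ℕ) : ℤ_[2]) * (2 * v) = u by push_cast; linear_combination -hv] at this
  refine ⟨i * g, ?_, ?_⟩
  · rw [← hsq] at hu
    exact (isUnit_pow_iff two_ne_zero).mp (isUnit_of_mul_isUnit_left hu)
  · rw [pow_two]
    ext
    · simp; linear_combination hsq
    · simp; ring

theorem unramifiedReduction_sqrt {w : ℤ_[2]} (hw : IsUnit w) :
    unramifiedReduction ⟨w, 2 * w⟩ = 1 := by
  have h1 : ∀ y : ZMod 2, y ≠ 0 → y = 1 := by decide
  have h2 : (2 : ZMod 2) = 0 := rfl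
  ext
  · simpa [unramifiedReduction] using h1 _ (hw.map PadicInt.toZMod).ne_zero
  · simp only [unramifiedReduction, RingHom.coe_mk, MonoidHom.coe_mk, OneHom.coe_mk, map_mul,
      map_ofNat, h2, zero_mul, im_one]

theorem not_sq_dvd_one_add_sqrt {w : ℤ_[2]} (hw : IsUnit w) :
    ¬ ((2 : ℕ) : UnramifiedQuadratic) ^ 2 ∣ 1 + ⟨w, 2 * w⟩ := by
  intro h
  rw [← Nat.cast_pow] at h
  obtain ⟨x, hx⟩ := h
  have h1 : w = 2 * x.im := by
    refine mul_left_cancel₀ (two_ne_zero (α := ℤ_[2])) ?_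
    have h2 := congrArg QuadraticAlgebra.im hx
    simp only [im_add, im_one, zero_add, im_mul, re_natCast, im_natCast, zero_mul, mul_zero,
      add_zero] at h2
    rw [h2]; push_cast; ring
  exact (PadicInt.prime_p (p := 2)).not_isUnit
    (isUnit_of_dvd_unit ⟨x.im, by exact_mod_cast h1⟩ hw)

end UnramifiedQuadratic

/-! ### The index at a prime not dividing `a`, in terms of `v_p(a ^ (p - 1) - 1)` -/

section NotDvdIndex

open Polynomial NumberField

variable {R k : Type*} [CommRing R] [Field k] {red : R →+* k} {p : ℕ}

theorem dvd_pow_sub_pow_of_map_pow_eq (hker : ∀ x, red x = 0 → (p : R) ∣ x) {c : R}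
    (hcp : red c ^ p = red c) (i j : ℕ) : (p : R) ∣ c ^ p ^ i - c ^ p ^ j := by
  have hcp' : ∀ j, red c ^ p ^ j = red c := by
    intro j
    induction j with
    | zero => simp
    | succ j ih => rw [pow_succ, pow_mul, ih, hcp]
  exact hker _ (by rw [map_sub, map_pow, map_pow, hcp', hcp', sub_self])

/-- If `p ^ 2 ∣ c ^ p ^ κ - c`, then `c ^ (p - 1) ≡ 1` modulo `p ^ 2`, and raising to the power
`p ^ r` would give `a ^ (p - 1) ≡ 1` modulo `p ^ (r + 2)`. -/
theorem not_sq_dvd_pow_sub [CharP k p] (hp0 : 0 < p) (hp : (p : R) ∈ nonZeroDivisors R)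
    (hker : ∀ x, red x = 0 → (p : R) ∣ x) {c : R} (hc : IsUnit c)
    (hcp : red c ^ p = red c) {a : ℤ} {r : ℕ} (hca : c ^ p ^ r = a)
    (ha : ¬ (p : ℤ) ^ (r + 2) ∣ a ^ (p - 1) - 1) {κ : ℕ} (hκ : 0 < κ) :
    ¬ (p : R) ^ 2 ∣ c ^ p ^ κ - c := by
  intro h
  have h1 : (p : R) ^ 2 ∣ c ^ p - c := by
    have h2 := pow_add_dvd_pow_sub_pow (p := p) (i := 0) (x := c ^ p ^ (κ - 1)) (y := c)
      (by simpa using dvd_pow_sub_pow_of_map_pow_eq hker hcp (κ - 1) 0) 1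
    rw [pow_one, ← pow_mul, ← pow_succ, Nat.sub_add_cancel hκ] at h2
    have := dvd_sub h h2
    rwa [sub_sub_sub_cancel_left] at this
  have h3 : (p : R) ^ 2 ∣ c ^ (p - 1) - 1 := by
    rw [show c ^ p - c = c * (c ^ (p - 1) - 1) by
      rw [mul_sub, ← pow_succ', Nat.sub_add_cancel hp0, mul_one]] at h1
    exact (hc.dvd_mul_left).mp h1
  have h4 := pow_add_dvd_pow_sub_pow (p := p) (i := 1) h3 r
  rw [one_pow, ← pow_mul, mul_comm, pow_mul, hca] at h4
  refine ha (pow_dvd_of_pow_dvd_intCast red hp ?_)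
  rw [show r + 2 = 1 + 1 + r by ring]
  exact_mod_cast h4

theorem not_sq_dvd_mul_pow (red : R →+* k) [CharP k p] (hp : (p : R) ∈ nonZeroDivisors R) {c : R}
    (hc : IsUnit c) (i : ℕ) : ¬ (p : R) ^ 2 ∣ p * c ^ i := by
  rintro ⟨w, hw⟩
  have h1 : (p : R) * (c ^ i - p * w) = 0 := by rw [mul_sub, hw]; ring
  have h2 := congrArg red (sub_eq_zero.mp (mem_nonZeroDivisors_iff_left.mp hp _ h1))
  rw [map_mul, map_natCast, CharP.cast_eq_zero, zero_mul] at h2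
  exact ((hc.pow i).map red).ne_zero h2

theorem not_sq_dvd_geomSum_of_odd (red : R →+* k) [CharP k p] (hodd : Odd p)
    (hp : (p : R) ∈ nonZeroDivisors R) {x z : R} (hz : IsUnit z) (h : (p : R) ∣ x - z) :
    ¬ (p : R) ^ 2 ∣ ∑ t ∈ Finset.range p, x ^ t * z ^ (p - 1 - t) := by
  obtain ⟨b, hb⟩ := h
  obtain rfl : x = z + p * b := by rw [← hb]; ring
  exact fun hd => not_sq_dvd_mul_pow red hp hz _
    ((dvd_iff_dvd_of_dvd_sub (odd_sq_dvd_geom_sum₂_sub z b hodd)).mp hd)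

theorem not_sq_dvd_geomSum_self (red : R →+* k) [CharP k p]
    (hp : (p : R) ∈ nonZeroDivisors R) {z : R} (hz : IsUnit z) :
    ¬ (p : R) ^ 2 ∣ ∑ t ∈ Finset.range p, z ^ t * z ^ (p - 1 - t) := by
  rw [geom_sum₂_self]
  exact not_sq_dvd_mul_pow red hp hz _

theorem pow_succ_dvd_sub_pow_pow {a : ℤ} {r j : ℕ} (h : (p : ℤ) ^ (r + 1) ∣ a ^ (p - 1) - 1)
    (hp0 : 0 < p) (hj : j ≤ r) : (p : ℤ) ^ (j + 1) ∣ a - a ^ p ^ j := by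
  refine ((pow_dvd_pow _ (by omega)).trans h).trans ?_
  obtain ⟨M, hM⟩ : p - 1 ∣ p ^ j - 1 := by simpa using Nat.sub_dvd_pow_sub_pow p 1 j
  have h1 : a ^ (p - 1) - 1 ∣ a ^ (p ^ j - 1) - 1 := by
    rw [hM, pow_mul]
    simpa using sub_dvd_pow_sub_pow (a ^ (p - 1)) 1 M
  rw [show a - a ^ p ^ j = (a ^ (p ^ j - 1) - 1) * -a by
    rw [show a ^ p ^ j = a ^ (p ^ j - 1) * a by
      rw [← pow_succ, Nat.sub_add_cancel (pow_pos hp0 j)]]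
    ring]
  exact h1.mul_right _

variable {K : Type*} [Field K] [NumberField K] {n : ℕ} {a : ℤ}

/-- The `p`-part of the index of `ℤ[θ]` when `p ∤ a`, where `r = v_p(a ^ (p - 1) - 1) - 1`: only
`m = min r s` of the `s` steps `n, n / p, …, n / p ^ s` contribute, since `a` is a `p ^ m`-th power
in an unramified extension of `ℤ_p` and the factors of `X ^ n - a` attached to this root define
maximal orders. -/
theorem discr_pow_eq_of_not_dvd [Fact p.Prime] (hirr : Irreducible (X ^ n - C a : ℤ[X]))
    {θ : 𝓞 K} (hroot : aeval θ (X ^ n - C a : ℤ[X]) = 0) (hfin : Module.finrank ℚ K = n)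
    {n' s r : ℕ} (hn : n = n' * p ^ s) (hn' : 0 < n') (hpn : ¬ p ∣ n') (hpa : ¬ (p : ℤ) ∣ a)
    (hr : (p : ℤ) ^ (r + 1) ∣ a ^ (p - 1) - 1) (hr' : ¬ (p : ℤ) ^ (r + 2) ∣ a ^ (p - 1) - 1) :
    ∃ D : ℤ, ¬ (p : ℤ) ∣ D ∧ Algebra.discr ℤ (fun i : Fin n => θ ^ (i : ℕ)) =
      (p : ℤ) ^ (2 * ∑ j ∈ Finset.Icc 1 (min r s), n' * p ^ (s - j)) * D ^ 2 * discr K := by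
  have hp : p.Prime := Fact.out
  have haj : ∀ j ≤ min r s, (p : ℤ) ^ (j + 1) ∣ a - a ^ p ^ j := fun j hj =>
    pow_succ_dvd_sub_pow_pow hr hp.pos (hj.trans (min_le_left _ _))
  have haZp : IsUnit (a : ℤ_[p]) := PadicInt.isUnit_of_not_dvd fun h => hpa (by
    have := (PadicInt.pow_p_dvd_int_iff (p := p) 1 a).mp (by simpa using h)
    simpa using this)
  set m := min r s with hm
  obtain ⟨κ, hκ⟩ : ∃ κ, s = κ + m := ⟨s - m, by omega⟩
  have hκr : 0 < κ → m = r := fun h => by omega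
  -- for `p` odd or `κ = 0` any `p ^ m`-th root of `a` in `ℤ_p` will do: the geometric sums in
  -- Dedekind's criterion are then never divisible by `p ^ 2`
  have main : ∀ c : ℤ_[p], c ^ p ^ m = a → (∀ l < m, κ = 0 ∨ Odd p) →
      ∃ D : ℤ, ¬ (p : ℤ) ∣ D ∧ Algebra.discr ℤ (fun i : Fin n => θ ^ (i : ℕ)) =
        (p : ℤ) ^ (2 * ∑ j ∈ Finset.Icc 1 m, n' * p ^ (s - j)) * D ^ 2 * discr K := by
    intro c hca hodd
    have hnzd := PadicInt.natCast_mem_nonZeroDivisors p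
    have hker := PadicInt.dvd_of_toZMod_eq_zero (p := p)
    have hc : IsUnit c := by
      rw [← hca] at haZp
      exact (isUnit_pow_iff (pow_pos hp.pos m).ne').mp haZp
    have hcp : PadicInt.toZMod c ^ p = PadicInt.toZMod c := ZMod.pow_card _
    rw [hκ]
    refine discr_pow_eq_of_root hirr hroot hfin hnzd (PadicInt.toZMod_surjective p) hker
      (hκ ▸ hn) hn' hpn hc hca hcp ?_ ?_ haj
    · rcases Nat.eq_zero_or_pos κ with h | h
      · exact .inl h
      · exact .inr (not_sq_dvd_pow_sub hp.pos hnzd hker hc hcp (hκr h ▸ hca) hr' h)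
    · intro l hl
      rcases hodd l hl with h | h
      · rw [h, zero_add]
        exact not_sq_dvd_geomSum_self PadicInt.toZMod hnzd (hc.pow _)
      · exact not_sq_dvd_geomSum_of_odd PadicInt.toZMod h hnzd (hc.pow _)
          (dvd_pow_sub_pow_of_map_pow_eq hker hcp _ _)
  rcases hp.eq_two_or_odd' with rfl | hodd
  · have hr2 : (2 : ℤ_[2]) ^ (r + 1) ∣ a - 1 := by
      have := (PadicInt.pow_p_dvd_int_iff (p := 2) (r + 1) (a - 1)).mpr (by simpa using hr)
      exact_mod_cast this
    rcases Nat.eq_zero_or_pos m with hm0 | hm0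
    · exact main a (by rw [hm0]; simp) (by omega)
    · rcases Nat.lt_or_ge s r with hsr | hsr
      · obtain ⟨c, hc, -⟩ := PadicInt.exists_pow_two_pow_eq m (u := (a : ℤ_[2]))
          ((pow_dvd_pow _ (by omega)).trans hr2)
        exact main c hc fun _ _ => .inl (by omega)
      · -- `a ≡ 1` modulo `2 ^ (r + 1)` but not modulo `2 ^ (r + 2)`, so its `2 ^ (r - 1)`-th root
        -- `u` is `5` modulo `8`: not a square in `ℤ_2`, but the square of a unit of `ℤ_2[ω]`
        have hmr : m = r := by omega
        obtain ⟨u, hu, hu4⟩ := PadicInt.exists_pow_two_pow_eq (m - 1) (u := (a : ℤ_[2]))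
          ((pow_dvd_pow _ (by omega)).trans hr2)
        have hu8 : ¬ (8 : ℤ_[2]) ∣ u - 1 := by
          intro h
          have h1 := pow_add_dvd_pow_sub_pow (p := 2) (i := 2) (x := u) (y := 1)
            (by norm_num; exact h) (m - 1)
          rw [hu, one_pow, show 2 + 1 + (m - 1) = r + 2 by omega] at h1
          refine hr' ?_
          have h2 := (PadicInt.pow_p_dvd_int_iff (p := 2) (r + 2) (a - 1)).mp
            (by exact_mod_cast h1)
          simpa using h2
        obtain ⟨w, hw, hcu⟩ := exists_sq_eq_of_mod_eight hu4 hu8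
        set c : UnramifiedQuadratic := ⟨w, 2 * w⟩ with hcdef
        have hca : c ^ 2 ^ m = (a : UnramifiedQuadratic) := by
          rw [show m = m - 1 + 1 by omega, pow_succ', pow_mul, hcu, ← map_pow, hu, map_intCast]
        have hc : IsUnit c := by
          rw [← hu] at haZp
          have h1 := ((isUnit_pow_iff (by positivity)).mp haZp).map
            (algebraMap ℤ_[2] UnramifiedQuadratic)
          rw [← hcu] at h1
          exact (isUnit_pow_iff two_ne_zero).mp h1
        have hcp : unramifiedReduction c ^ 2 = unramifiedReduction c := by
          rw [hcdef, unramifiedReduction_sqrt hw, one_pow]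
        have hnzd := two_mem_nonZeroDivisors_unramifiedQuadratic
        have hker := dvd_of_unramifiedReduction_eq_zero
        have hκc : ((2 : ℕ) : UnramifiedQuadratic) ∣ c ^ 2 ^ κ - c := by
          simpa using dvd_pow_sub_pow_of_map_pow_eq hker hcp κ 0
        rw [hκ]
        refine discr_pow_eq_of_root hirr hroot hfin hnzd unramifiedReduction_surjective hker
          (hκ ▸ hn) hn' hpn hc hca hcp ?_ ?_ haj
        · rcases Nat.eq_zero_or_pos κ with h | h
          · exact .inl h
          · exact .inr (not_sq_dvd_pow_sub hp.pos hnzd hker hc hcp (hκr h ▸ hca) hr' h)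
        · intro l hl
          rcases Nat.eq_zero_or_pos κ with h | h
          · rw [h, zero_add]
            exact not_sq_dvd_geomSum_self unramifiedReduction hnzd (hc.pow _)
          rcases Nat.eq_zero_or_pos l with hl0 | hl0
          · -- the sum is congruent to `c ^ 2 + c` modulo `4`
            intro hd
            simp only [hl0, Finset.sum_range_succ, Finset.sum_range_zero] at hd
            have h1 := pow_add_dvd_pow_sub_pow (p := 2) (i := 0)
              (by simpa using dvd_pow_sub_pow_of_map_pow_eq hker hcp (κ - 1) 0) 1
            rw [pow_one, ← pow_mul, ← pow_succ, Nat.sub_add_cancel h] at h1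
            have h2 : ((2 : ℕ) : UnramifiedQuadratic) ^ 2 ∣ c * (1 + c) := by
              have := dvd_sub hd h1
              refine this.trans (dvd_of_eq ?_)
              simp only [add_zero, pow_zero, pow_one, zero_add, one_mul, tsub_zero, mul_one,
                Nat.add_one_sub_one, tsub_self]
              ring
            exact not_sq_dvd_one_add_sqrt hw (hc.dvd_mul_left.mp h2)
          · have h1 := pow_add_dvd_pow_sub_pow (p := 2) (i := 0) (by simpa using hκc) l
            rw [← pow_mul, ← pow_add] at h1
            have h2 := (pow_dvd_pow _ (show 2 ≤ 0 + 1 + l by omega)).trans h1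
            intro hd
            refine not_sq_dvd_mul_pow unramifiedReduction hnzd (hc.pow (2 ^ l)) 1 ?_
            refine (dvd_sub hd h2).trans (dvd_of_eq ?_)
            simp only [Finset.sum_range_succ, Finset.sum_range_zero]
            push_cast
            simp only [pow_zero, pow_one, zero_add, one_mul, mul_one]
            ring
  · obtain ⟨c, -, hc⟩ := PadicInt.exists_pow_pow_eq_of_odd hodd m haZp (by
      have := (PadicInt.pow_p_dvd_int_iff (p := p) (m + 1) (a ^ (p - 1) - 1)).mpr
        ((pow_dvd_pow _ (by omega)).trans hr)
      exact_mod_cast this)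
    exact main c hc fun _ _ => .inr hodd

end NotDvdIndex

/-! ### The index at a prime dividing `a` -/

section DvdIndex

open Polynomial NumberField

/-- The reduction of `S[Y] / (Y ^ n' - q s)`, with `S = R[T] / (f)`, modulo `q` and `Y`. -/
noncomputable def eisensteinReduction {R k : Type*} [CommRing R] [Field k] {red : R →+* k} {q : ℕ}
    (h0 : red q = 0) (f : R[X]) {n' : ℕ} (hn' : n' ≠ 0) (s : AdjoinRoot f) :
    AdjoinRoot (X ^ n' - C ((q : AdjoinRoot f) * s)) →+* AdjoinRoot (f.map red) :=
  AdjoinRoot.lift (AdjoinRoot.map red f (f.map red) dvd_rfl) 0 (by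
    have : AdjoinRoot.map red f (f.map red) dvd_rfl (q : AdjoinRoot f) = 0 := by
      rw [map_natCast, ← map_natCast (AdjoinRoot.of (f.map red)), ← map_natCast red, h0, map_zero]
    rw [eval₂_sub, eval₂_pow, eval₂_X, eval₂_C, map_mul, this, zero_pow hn', zero_mul, sub_zero])

/-- An Eisenstein polynomial over an unramified extension defines a maximal order: `Y` plays the
role of the uniformiser, with `Y ^ n' = q s` and `s` a unit. -/
theorem isSaturatedAt_eisenstein {R k : Type*} [CommRing R] [Field k] {red : R →+* k} {q : ℕ}
    (hq : (q : R) ∈ nonZeroDivisors R) (h0 : red q = 0)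
    (hsurj : Function.Surjective red) (hker : ∀ x, red x = 0 → (q : R) ∣ x) {f : R[X]}
    (hf : f.Monic) (hsq : Squarefree (f.map red)) {n' : ℕ} (hn' : n' ≠ 0) {s : AdjoinRoot f}
    (hs : IsUnit s) : IsSaturatedAt (AdjoinRoot (X ^ n' - C ((q : AdjoinRoot f) * s))) q := by
  intro P κ z hP hz
  have := AdjoinRoot.isReduced_of_squarefree hsq
  have hqS : (q : AdjoinRoot f) ∈ nonZeroDivisors (AdjoinRoot f) := by
    simpa using AdjoinRoot.of_mem_nonZeroDivisors hf hq
  set g : (AdjoinRoot f)[X] := X ^ n' - C ((q : AdjoinRoot f) * s) with hg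
  have hqA : (q : AdjoinRoot g) ∈ nonZeroDivisors (AdjoinRoot g) := by
    simpa using AdjoinRoot.of_mem_nonZeroDivisors (monic_X_pow_sub_C _ hn') hqS
  refine pow_dvd_of_scaleRoots_eval_eq_zero (φ := AdjoinRoot.root g) (F := AdjoinRoot.of g s)
    (e := n') hqA ?_ (eisensteinReduction h0 f hn' s) ?_ ?_ ?_ hP κ hz
  · have h1 := AdjoinRoot.mk_self (f := g)
    rw [hg, map_sub, sub_eq_zero, map_pow, AdjoinRoot.mk_X, AdjoinRoot.mk_C, ← hg, map_mul,
      map_natCast] at h1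
    exact h1
  · intro z hz
    obtain ⟨h, rfl⟩ := AdjoinRoot.mk_surjective z
    rw [eisensteinReduction, AdjoinRoot.lift_mk, eval₂_at_zero] at hz
    have h1 := mem_span_of_adjoinRoot_map_eq_zero hsurj hker dvd_rfl _ hz
    rw [AdjoinRoot.mk_self, Ideal.mem_span_pair] at h1
    obtain ⟨u, v, huv⟩ := h1
    refine Ideal.mem_span_pair.mpr ⟨AdjoinRoot.mk g h.divX, AdjoinRoot.of g v, ?_⟩
    conv_rhs => rw [← divX_mul_X_add h, ← huv]
    simp
  · rw [eisensteinReduction, AdjoinRoot.lift_root]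
  · rw [eisensteinReduction, AdjoinRoot.lift_of]
    exact hs.map _

theorem pow_dvd_coeff_of_dvd_mk {R : Type*} [CommRing R] [Nontrivial R] {f G : R[X]}
    (hf : f.Monic) (hG : G.degree < f.degree) {x : R}
    (h : AdjoinRoot.mk f (C x) ∣ AdjoinRoot.mk f G) (i : ℕ) : x ∣ G.coeff i := by
  have h1 := pow_dvd_modByMonic hf h
  rw [(modByMonic_eq_self_iff hf).mpr hG] at h1
  exact (C_dvd_iff_dvd_coeff _ _).mp h1 i

/-- In `A = R[T] / (f) [Y] / (Y ^ n' - q T ^ u)`, the powers of `Y ^ t' * T ^ (-w)` (with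
`u t' - w n' = 1`) are, up to units and the factors `q ^ (d t' / n')`, the basis `T ^ l * Y ^ ρ`
of `A` over `R`. -/
theorem pow_dvd_coeff_of_dvd_eval₂ {R : Type*} [CommRing R] [Nontrivial R] {f : R[X]} (hf : f.Monic)
    {g : ℕ} (hfg : f.natDegree = g) (hg : 0 < g) {q n' t' u w : ℕ} (hn' : 0 < n')
    (hcop : n'.Coprime t') (huw : u * t' = w * n' + 1) {V : AdjoinRoot f}
    (hV : AdjoinRoot.root f * V = 1) {H : ℤ[X]} (hH : H.natDegree < n' * g) {κ : ℕ}
    (h : ((q : AdjoinRoot (X ^ n' - C ((q : AdjoinRoot f) * AdjoinRoot.root f ^ u))) ^ κ ∣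
      H.eval₂ (Int.castRingHom _) (AdjoinRoot.root _ ^ t' * AdjoinRoot.of _ V ^ w))) (d : ℕ)
    (hd : d < n' * g) :
    (q : R) ^ κ ∣ (H.coeff d : R) * (q : R) ^ (d * t' / n') := by
  set T : AdjoinRoot f := AdjoinRoot.root f with hT
  set F : (AdjoinRoot f)[X] := X ^ n' - C ((q : AdjoinRoot f) * T ^ u) with hF
  have hFm : F.Monic := monic_X_pow_sub_C _ hn'.ne'
  have : Nontrivial (AdjoinRoot f) := by
    refine nontrivial_of_ne (AdjoinRoot.mk f 1) 0 ?_
    exact AdjoinRoot.mk_ne_zero_of_natDegree_lt hf one_ne_zero (by rw [natDegree_one, hfg]; exact hg)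
  set Y := AdjoinRoot.root F with hY
  have hYn : Y ^ n' = AdjoinRoot.of F ((q : AdjoinRoot f) * T ^ u) := by
    have h1 := AdjoinRoot.mk_self (f := F)
    rwa [hF, map_sub, sub_eq_zero, map_pow, AdjoinRoot.mk_X, AdjoinRoot.mk_C, ← hF] at h1
  let c : ℕ → AdjoinRoot f := fun j => T ^ (u * (j * t' / n')) * V ^ (w * j)
  have hmod : ∀ i, i * t' / n' = (i % n') * t' / n' + (i / n') * t' := fun i => by
    conv_lhs => rw [← Nat.mod_add_div i n', add_mul, mul_assoc, mul_comm n' (i / n' * t')]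
    rw [Nat.add_mul_div_right _ _ hn']
  have hTV : T ^ (u * t') * V ^ (w * n') = T := by
    rw [huw, pow_succ', mul_assoc, ← mul_pow, hV, one_pow, mul_one]
  have hterm : ∀ i, (Y ^ t' * AdjoinRoot.of F V ^ w) ^ i =
      AdjoinRoot.of F ((q : AdjoinRoot f) ^ (i * t' / n') * (c (i % n') * T ^ (i / n'))) *
        Y ^ (i * t' % n') := by
    intro i
    have h1 : Y ^ (t' * i) = AdjoinRoot.of F ((q : AdjoinRoot f) * T ^ u) ^ (i * t' / n') *
        Y ^ (i * t' % n') := by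
      rw [← hYn, ← pow_mul, ← pow_add, Nat.div_add_mod, mul_comm]
    have h2 : T ^ (u * (i * t' / n')) * V ^ (w * i) = c (i % n') * T ^ (i / n') := by
      conv_rhs => rw [← hTV, mul_pow, ← pow_mul, ← pow_mul]
      conv_lhs => rw [hmod i, show w * i = w * (i % n') + w * n' * (i / n') by
        conv_lhs => rw [← Nat.mod_add_div i n']
        ring]
      simp only [c]
      ring
    rw [mul_pow, ← pow_mul, ← pow_mul, h1, ← h2, map_mul, map_pow, map_mul, map_pow, map_mul,
      map_pow, map_pow]
    ring
  let G : (AdjoinRoot f)[X] := ∑ i ∈ Finset.range (n' * g),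
    C ((H.coeff i : AdjoinRoot f) *
      ((q : AdjoinRoot f) ^ (i * t' / n') * (c (i % n') * T ^ (i / n')))) * X ^ (i * t' % n')
  have hGdeg : G.degree < F.degree := by
    rw [hF, degree_X_pow_sub_C hn']
    refine (degree_sum_le _ _).trans_lt ((Finset.sup_lt_iff (by simp)).mpr fun i _ => ?_)
    exact (degree_C_mul_X_pow_le _ _).trans_lt (by exact_mod_cast Nat.mod_lt _ hn')
  have hGmk : AdjoinRoot.mk F G = H.eval₂ (Int.castRingHom _) (Y ^ t' * AdjoinRoot.of F V ^ w) := by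
    rw [eval₂_eq_sum_range' _ hH, map_sum]
    refine Finset.sum_congr rfl fun i _ => ?_
    rw [hterm, map_mul, AdjoinRoot.mk_C, map_pow, AdjoinRoot.mk_X, map_mul, map_intCast,
      eq_intCast, mul_assoc]
  have h1 : (q : AdjoinRoot f) ^ κ ∣ G.coeff (d * t' % n') := by
    refine pow_dvd_coeff_of_dvd_mk hFm hGdeg ?_ _
    rw [hGmk, AdjoinRoot.mk_C, map_pow, map_natCast]
    exact h
  -- `i ↦ i t'` is injective modulo `n'`, so the coefficient of `Y ^ (d t' mod n')` only involves
  -- the `i ≡ d` modulo `n'`, which are told apart by the power of `T`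
  let L : R[X] := ∑ i ∈ Finset.range (n' * g),
    if i % n' = d % n' then C ((H.coeff i : R) * (q : R) ^ (i * t' / n')) * X ^ (i / n') else 0
  have hinj : ∀ i, d * t' % n' = i * t' % n' ↔ i % n' = d % n' := by
    intro i
    constructor
    · intro h
      exact (Nat.ModEq.cancel_right_of_coprime hcop h).symm
    · intro h
      exact ((show i ≡ d [MOD n'] from h).mul_right t').symm
  have hLmk : G.coeff (d * t' % n') = c (d % n') * AdjoinRoot.mk f L := by
    simp only [G, L, finsetSum_coeff, coeff_C_mul, coeff_X_pow, map_sum, Finset.mul_sum, hinj]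
    refine Finset.sum_congr rfl fun i _ => ?_
    split_ifs with hi
    · rw [hi, map_mul, AdjoinRoot.mk_C, map_pow, AdjoinRoot.mk_X, map_mul, map_pow, map_intCast,
        map_natCast]
      ring
    · simp
  have hTu : IsUnit T := .of_mul_eq_one _ hV
  have hVu : IsUnit V := .of_mul_eq_one_right _ hV
  have hcu : IsUnit (c (d % n')) := (hTu.pow _).mul (hVu.pow _)
  have hLdeg : L.degree < f.degree := by
    rw [degree_eq_natDegree hf.ne_zero, hfg]
    refine (degree_sum_le _ _).trans_lt ((Finset.sup_lt_iff ?_).mpr fun i hi => ?_)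
    · exact_mod_cast WithBot.bot_lt_coe g
    · split_ifs
      · refine (degree_C_mul_X_pow_le _ _).trans_lt ?_
        exact_mod_cast Nat.div_lt_of_lt_mul (Finset.mem_range.mp hi)
      · rw [degree_zero]
        exact_mod_cast WithBot.bot_lt_coe g
  have h2 : (q : R) ^ κ ∣ L.coeff (d / n') := by
    refine pow_dvd_coeff_of_dvd_mk hf hLdeg ?_ _
    rw [AdjoinRoot.mk_C, map_pow, map_natCast]
    rw [hLmk] at h1
    exact hcu.dvd_mul_left.mp h1
  have h3 : L.coeff (d / n') = (H.coeff d : R) * (q : R) ^ (d * t' / n') := by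
    simp only [L, finsetSum_coeff]
    rw [Finset.sum_eq_single d]
    · rw [if_pos rfl, coeff_C_mul, coeff_X_pow, if_pos rfl, mul_one]
    · intro i _ hid
      split_ifs with hi
      · rw [coeff_C_mul, coeff_X_pow, if_neg, mul_zero]
        intro hdiv
        exact hid (by rw [← Nat.mod_add_div i n', hi, ← hdiv, Nat.mod_add_div])
      · simp
    · intro hd'
      exact absurd (Finset.mem_range.mpr hd) hd'
  rwa [h3] at h2

/-- The sum of the integer parts of `d t / n`, `0 ≤ d < n`, by pairing `d` with `n - d`. -/
theorem two_mul_sum_div_add (n t : ℕ) (hn : 0 < n) :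
    2 * ∑ d ∈ Finset.range n, d * t / n + n = (n - 1) * t + Nat.gcd n t := by
  obtain ⟨N, rfl⟩ : ∃ N, n = N + 1 := ⟨n - 1, by omega⟩
  set n := N + 1 with hnN
  set g := Nat.gcd n t with hg
  have hg0 : 0 < g := Nat.gcd_pos_of_pos_left _ hn
  obtain ⟨n', hn'⟩ : g ∣ n := Nat.gcd_dvd_left n t
  have hdvd : ∀ a, n ∣ a * t ↔ n' ∣ a := by
    intro a
    obtain ⟨t', ht'⟩ : g ∣ t := Nat.gcd_dvd_right n t
    have hcop : n'.Coprime t' := by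
      have := Nat.coprime_div_gcd_div_gcd (m := n) (n := t) hg0
      rw [← hg] at this
      rwa [hn', ht', Nat.mul_div_cancel_left _ hg0, Nat.mul_div_cancel_left _ hg0] at this
    rw [hn', ht', mul_left_comm, Nat.mul_dvd_mul_iff_left hg0]
    exact hcop.dvd_mul_right
  have hpair : ∀ a, a < n → a * t / n + (n - a) * t / n + 1 = t + if n' ∣ a then 1 else 0 := by
    intro a ha
    obtain ⟨b, hb⟩ : ∃ b, n = a + b := ⟨n - a, by omega⟩
    rw [show n - a = b by omega]
    have h1 : a * t + b * t = n * t := by rw [hb]; ring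
    have h2 := Nat.div_add_mod (a * t) n
    have h3 := Nat.div_add_mod (b * t) n
    have h4 := Nat.mod_lt (a * t) hn
    have h5 := Nat.mod_lt (b * t) hn
    have h6 : n * (a * t / n + b * t / n) + (a * t % n + b * t % n) = n * t := by
      rw [← h1]; linear_combination h2 + h3
    split_ifs with h
    · have h7 : a * t % n = 0 := Nat.mod_eq_zero_of_dvd ((hdvd a).mpr h)
      have h8 : b * t % n = 0 := by
        refine Nat.mod_eq_zero_of_dvd ((Nat.dvd_add_right ((hdvd a).mpr h)).mp ?_)
        rw [h1]; exact dvd_mul_right _ _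
      rw [h7, h8, add_zero, add_zero] at h6
      rw [Nat.eq_of_mul_eq_mul_left hn h6]
    · have h7 : 0 < a * t % n := Nat.pos_of_ne_zero fun h0 =>
        h ((hdvd a).mp (Nat.dvd_of_mod_eq_zero h0))
      have h8 : n ∣ a * t % n + b * t % n :=
        (Nat.dvd_add_right (dvd_mul_right n _)).mp (h6 ▸ dvd_mul_right n t)
      obtain ⟨x, hx⟩ := h8
      have hx1 : x = 1 := by
        rcases x with _ | _ | x
        · omega
        · rfl
        · have : n * (x + 1 + 1) = n * x + n + n := by ring
          omega
      rw [hx, hx1, ← mul_add] at h6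
      rw [Nat.eq_of_mul_eq_mul_left hn h6, add_zero]
  have hcount : ∑ j ∈ Finset.range N, (if n' ∣ j + 1 then 1 else 0) + 1 = g := by
    have h1 := Nat.card_multiples n n'
    rw [Finset.card_filter, hnN, Finset.sum_range_succ, ← hnN, if_pos ⟨g, by rw [hn', mul_comm]⟩]
      at h1
    rw [h1]
    conv_lhs => rw [hn']
    refine Nat.mul_div_cancel _ (Nat.pos_of_ne_zero ?_)
    rintro rfl
    omega
  have hsum : ∑ d ∈ Finset.range n, d * t / n = ∑ j ∈ Finset.range N, (j + 1) * t / n := by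
    rw [hnN, Finset.sum_range_succ']
    simp
  have hrefl : ∑ j ∈ Finset.range N, (n - (j + 1)) * t / n =
      ∑ j ∈ Finset.range N, (j + 1) * t / n := by
    rw [← Finset.sum_range_reflect]
    refine Finset.sum_congr rfl fun j hj => ?_
    rw [Finset.mem_range] at hj
    congr 2
    omega
  have htot := Finset.sum_congr rfl fun j (hj : j ∈ Finset.range N) =>
    hpair (j + 1) (by rw [Finset.mem_range] at hj; omega)
  simp only [Finset.sum_add_distrib, hrefl, Finset.sum_const, Finset.card_range, smul_eq_mul,
    mul_one] at htot
  rw [hsum, show n - 1 = N by omega]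
  omega

/-- The `q`-part of the index of `ℤ[θ]` when `q ^ t` divides `a` exactly. With `g = gcd(n, t)`,
`n = n' g`, `t = t' g` and `a = q ^ t a₀`, the root `θ` is sent to `Y ^ t' T ^ (-w)`, where
`T ^ g = a₀` and `Y ^ n' = q T ^ u`; as `q ∤ g`, adjoining `T` is unramified. -/
theorem discr_pow_eq_of_dvd {K : Type*} [Field K] [NumberField K] {n : ℕ} {a : ℤ}
    (hirr : Irreducible (X ^ n - C a : ℤ[X])) {θ : 𝓞 K}
    (hroot : aeval θ (X ^ n - C a : ℤ[X]) = 0) (hfin : Module.finrank ℚ K = n) (hn : 0 < n)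
    {q : ℕ} [Fact q.Prime] {t : ℕ} (ht : 0 < t) {a₀ : ℤ} (hat : a = (q : ℤ) ^ t * a₀)
    (ha₀ : ¬ (q : ℤ) ∣ a₀) (hg : ¬ q ∣ Nat.gcd n t) :
    ∃ D : ℤ, ¬ (q : ℤ) ∣ D ∧ Algebra.discr ℤ (fun i : Fin n => θ ^ (i : ℕ)) =
      (q : ℤ) ^ (2 * ∑ d ∈ Finset.range n, d * t / n) * D ^ 2 * discr K := by
  have hq : q.Prime := Fact.out
  have hθ : θ ^ n = (a : 𝓞 K) := by
    simpa [sub_eq_zero] using hroot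
  have hθK : (θ : K) ^ n = (a : K) := by
    simpa using congrArg (algebraMap (𝓞 K) K) hθ
  refine discr_pow_eq_of_leadingCoeff hfin θ hq (fun d => d * t / n) (fun d => X ^ d) ?_ ?_
  · intro d hd
    refine ⟨monic_X_pow d, natDegree_X_pow d, ?_⟩
    have hq0 : (q : K) ≠ 0 := by exact_mod_cast hq.ne_zero
    have hint : IsIntegral ℤ ((θ : K) ^ d / (q : K) ^ (d * t / n)) := by
      refine IsIntegral.of_pow hn ?_
      have h1 : ((θ : K) ^ d / (q : K) ^ (d * t / n)) ^ n =
          (((q : ℤ) ^ (d * t - d * t / n * n) * a₀ ^ d : ℤ) : K) := by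
        rw [div_pow, ← pow_mul, mul_comm d n, pow_mul, hθK, hat, div_eq_iff (by positivity)]
        push_cast
        rw [mul_pow, ← pow_mul, ← pow_mul, mul_right_comm, ← pow_add,
          Nat.sub_add_cancel (Nat.div_mul_le_self _ _), mul_comm t d]
      rw [h1]
      exact isIntegral_algebraMap (R := ℤ)
    obtain ⟨w, hw⟩ := (IsIntegralClosure.isIntegral_iff (A := 𝓞 K)).mp hint
    refine ⟨w, ?_⟩
    apply RingOfIntegers.ext
    simp only [map_mul, map_pow, aeval_X, map_natCast, hw]
    exact mul_div_cancel₀ _ (pow_ne_zero _ hq0)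
  · intro H hH κ y hy
    set g := Nat.gcd n t with hgdef
    have hg0 : 0 < g := Nat.gcd_pos_of_pos_left _ hn
    obtain ⟨n', hn'⟩ : g ∣ n := Nat.gcd_dvd_left n t
    obtain ⟨t', ht'⟩ : g ∣ t := Nat.gcd_dvd_right n t
    have hn'0 : 0 < n' := Nat.pos_of_ne_zero (by rintro rfl; omega)
    have ht'0 : 0 < t' := Nat.pos_of_ne_zero (by rintro rfl; omega)
    have hcop : n'.Coprime t' := by
      have := Nat.coprime_div_gcd_div_gcd (m := n) (n := t) hg0
      rw [← hgdef] at this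
      rwa [hn', ht', Nat.mul_div_cancel_left _ hg0, Nat.mul_div_cancel_left _ hg0] at this
    obtain ⟨u, w, huw⟩ : ∃ u w, u * t' = w * n' + 1 := by
      rcases Nat.lt_or_ge 1 n' with h1 | h1
      · obtain ⟨u, -, hu⟩ := Nat.exists_mul_mod_eq_one_of_coprime hcop.symm h1
        exact ⟨u, t' * u / n', by rw [mul_comm u, mul_comm _ n', ← hu, Nat.div_add_mod]⟩
      · exact ⟨1, t' - 1, by rw [show n' = 1 by omega]; omega⟩
    have ha₀u : IsUnit (a₀ : ℤ_[q]) := PadicInt.isUnit_of_not_dvd fun h => ha₀ (by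
      have := (PadicInt.pow_p_dvd_int_iff (p := q) 1 a₀).mp (by simpa using h)
      simpa using this)
    set f : ℤ_[q][X] := X ^ g - C (a₀ : ℤ_[q]) with hf
    have hfm : f.Monic := monic_X_pow_sub_C _ hg0.ne'
    have hTg : AdjoinRoot.root f ^ g = AdjoinRoot.of f (a₀ : ℤ_[q]) := by
      have h1 := AdjoinRoot.mk_self (f := f)
      rwa [hf, map_sub, sub_eq_zero, map_pow, AdjoinRoot.mk_X, AdjoinRoot.mk_C, ← hf] at h1
    have hTu : IsUnit (AdjoinRoot.root f) := by
      refine (isUnit_pow_iff hg0.ne').mp ?_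
      rw [hTg]
      exact ha₀u.map _
    obtain ⟨V, hV⟩ := hTu.exists_right_inv
    set A := AdjoinRoot (X ^ n' - C ((q : AdjoinRoot f) * AdjoinRoot.root f ^ u)) with hA
    have hsat : IsSaturatedAt A q := by
      refine isSaturatedAt_eisenstein (red := PadicInt.toZMod)
        (PadicInt.natCast_mem_nonZeroDivisors q) (by simp) (PadicInt.toZMod_surjective q)
        PadicInt.dvd_of_toZMod_eq_zero hfm ?_ hn'0.ne' (hTu.pow u)
      rw [hf, Polynomial.map_sub, Polynomial.map_pow, map_X, map_C]
      exact (separable_X_pow_sub_C' q g _ hg (ha₀u.map PadicInt.toZMod).ne_zero).squarefree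
    set τ : A := AdjoinRoot.root _ ^ t' * AdjoinRoot.of _ V ^ w with hτ
    have hτn : (X ^ n - C a : ℤ[X]).eval₂ (Int.castRingHom A) τ = 0 := by
      set F : (AdjoinRoot f)[X] := X ^ n' - C ((q : AdjoinRoot f) * AdjoinRoot.root f ^ u) with hF
      have hYn : AdjoinRoot.root F ^ n' = AdjoinRoot.of F (q * AdjoinRoot.root f ^ u) := by
        have h1 := AdjoinRoot.mk_self (f := F)
        rwa [hF, map_sub, sub_eq_zero, map_pow, AdjoinRoot.mk_X, AdjoinRoot.mk_C, ← hF] at h1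
      have hTV : AdjoinRoot.root f ^ (u * t') * V ^ (w * n') = AdjoinRoot.root f := by
        rw [huw, pow_succ', mul_assoc, ← mul_pow, hV, one_pow, mul_one]
      have h1 : τ ^ n = AdjoinRoot.of F ((q : AdjoinRoot f) ^ t *
          (AdjoinRoot.root f ^ (u * t') * V ^ (w * n')) ^ g) := by
        rw [hτ, mul_pow, ← pow_mul, show t' * n = n' * t by rw [hn', ht']; ring, pow_mul, hYn,
          ← pow_mul, ← map_pow, ← map_pow, ← map_mul]
        congr 1
        rw [mul_pow, ← pow_mul, mul_pow, ← pow_mul, ← pow_mul, hn', ht']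
        ring
      rw [eval₂_sub, eval₂_pow, eval₂_X, eval₂_C, h1, hTV, hTg, hat]
      simp
    obtain ⟨P, hP, hP'⟩ := exists_monic_scaleRoots_eval_eq_zero (y := (y : K)) (θ := (θ : K))
      (b := (q : ℤ) ^ κ) (H := H) (monic_X_pow_sub_C a hn.ne') hirr
      (by simp [hθK])
      (RingOfIntegers.isIntegral_coe y)
      (by
        have := congrArg (algebraMap (𝓞 K) K) hy
        rw [← aeval_algebraMap_apply] at this
        rw [← this]
        simp) hτn
    have h3 := hsat P κ _ hP (by simpa using hP')
    have h4 := pow_dvd_coeff_of_dvd_eval₂ hfm (by rw [hf, natDegree_X_pow_sub_C]) hg0 hn'0 hcop huw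
      hV (by rw [mul_comm, ← hn']; exact hH) h3 H.natDegree (by rw [mul_comm, ← hn']; exact hH)
    have h5 : H.natDegree * t / n = H.natDegree * t' / n' := by
      conv_lhs => rw [hn', ht']
      rw [mul_left_comm, Nat.mul_div_mul_left _ _ hg0]
    rw [h5, mul_comm]
    refine pow_dvd_of_pow_dvd_intCast (PadicInt.toZMod (p := q))
      (PadicInt.natCast_mem_nonZeroDivisors q) ?_
    rw [leadingCoeff]
    exact_mod_cast h4

end DvdIndex

/-! ### The discriminant of `1, θ, …, θ ^ (n - 1)` -/

section PureField

open Polynomial NumberField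

/-- The determinant of `1, θ, …, θ ^ (n - 1)` in an integral basis serves as `T`. -/
theorem exists_discr_pow_eq_sq_mul {K : Type*} [Field K] [NumberField K] {n : ℕ}
    (hn : Module.finrank ℚ K = n) (θ : 𝓞 K) :
    ∃ T : ℤ, Algebra.discr ℤ (fun i : Fin n => θ ^ (i : ℕ)) = T ^ 2 * discr K := by
  classical
  have hcard : Fintype.card (Module.Free.ChooseBasisIndex ℤ (𝓞 K)) = Fintype.card (Fin n) := by
    rw [← Module.finrank_eq_card_chooseBasisIndex, RingOfIntegers.rank, hn, Fintype.card_fin]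
  let ω : Module.Basis (Fin n) ℤ (𝓞 K) :=
    (RingOfIntegers.basis K).reindex (Fintype.equivOfCardEq hcard)
  let T : Matrix (Fin n) (Fin n) ℤ := Matrix.of fun i j => ω.repr (θ ^ (i : ℕ)) j
  have hT : (T.map (algebraMap ℤ (𝓞 K))).mulVec ω = fun i : Fin n => θ ^ (i : ℕ) := by
    ext1 i
    conv_rhs => rw [← ω.sum_repr (θ ^ (i : ℕ))]
    simp [Matrix.mulVec, dotProduct, T, Algebra.smul_def]
  refine ⟨T.det, ?_⟩
  rw [← discr_eq_discr K ω, ← Algebra.discr_of_matrix_mulVec (A := ℤ) ω T, hT]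

theorem discr_int_eq_discr_rat {K : Type*} [Field K] [NumberField K] {ι : Type*} [Fintype ι]
    [DecidableEq ι] (b : ι → 𝓞 K) :
    ((Algebra.discr ℤ b : ℤ) : ℚ) = Algebra.discr ℚ (fun i => (b i : K)) := by
  rw [Algebra.discr_def, Algebra.discr_def, ← eq_intCast (Int.castRingHom ℚ), RingHom.map_det]
  congr 1
  ext i j
  simp only [RingHom.mapMatrix_apply, Matrix.map_apply, Algebra.traceMatrix_apply,
    Algebra.traceForm_apply, Int.coe_castRingHom, Algebra.coe_trace_int]
  simp

theorem discr_pow_pure {K : Type*} [Field K] [NumberField K] {n : ℕ} {a : ℤ} (hn : 0 < n)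
    (hirr : Irreducible (X ^ n - C a : ℤ[X])) {θ : 𝓞 K}
    (hroot : aeval (θ : K) (X ^ n - C a : ℤ[X]) = 0)
    (hgen : IntermediateField.adjoin ℚ {(θ : K)} = ⊤) :
    Module.finrank ℚ K = n ∧ Algebra.discr ℤ (fun i : Fin n => θ ^ (i : ℕ)) =
      (-1) ^ ((n - 1) * (n - 2) / 2) * (n ^ n * a ^ (n - 1)) := by
  have hint : IsIntegral ℚ (θ : K) := Algebra.IsIntegral.isIntegral _
  have hmin : minpoly ℚ (θ : K) = X ^ n - C (a : ℚ) := by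
    rw [minpoly.isIntegrallyClosed_eq_field_fractions' ℚ (RingOfIntegers.isIntegral_coe θ),
      minpoly_eq_of_irreducible (monic_X_pow_sub_C a hn.ne') hirr hroot]
    simp
  have hadj : Algebra.adjoin ℚ {(θ : K)} = ⊤ := by
    rw [← IntermediateField.adjoin_simple_toSubalgebra_of_isAlgebraic hint.isAlgebraic, hgen,
      IntermediateField.top_toSubalgebra]
  let pb : PowerBasis ℚ K := PowerBasis.ofAdjoinEqTop hint hadj
  have hgenpb : pb.gen = (θ : K) := PowerBasis.ofAdjoinEqTop_gen hint hadj
  have hdim : pb.dim = n := by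
    rw [← pb.natDegree_minpoly, hgenpb, hmin, natDegree_X_pow_sub_C]
  have hfin : Module.finrank ℚ K = n := pb.finrank.trans hdim
  refine ⟨hfin, ?_⟩
  have hnorm : Algebra.norm ℚ (θ : K) = (-1) ^ n * (-a) := by
    have := Algebra.PowerBasis.norm_gen_eq_coeff_zero_minpoly pb
    rw [hgenpb, hmin, hdim] at this
    rw [this]
    simp [hn.ne]
  have h1 := Algebra.discr_powerBasis_eq_norm ℚ pb
  rw [hfin, hgenpb, hmin] at h1
  have h2 : aeval (θ : K) (derivative (X ^ n - C (a : ℚ))) =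
      algebraMap ℚ K n * (θ : K) ^ (n - 1) := by
    simp [derivative_X_pow]
  rw [h2, map_mul, Algebra.norm_algebraMap, hfin, map_pow, hnorm] at h1
  have h3 : Algebra.discr ℚ pb.basis = Algebra.discr ℚ (fun i : Fin n => (θ : K) ^ (i : ℕ)) := by
    rw [← Algebra.discr_reindex ℚ pb.basis (finCongr hdim)]
    congr 1
    ext i
    simp [hgenpb]
  have h4 := discr_int_eq_discr_rat (fun i : Fin n => θ ^ (i : ℕ))
  have h5 : (fun i : Fin n => ((θ ^ (i : ℕ) : 𝓞 K) : K)) = fun i : Fin n => (θ : K) ^ (i : ℕ) := by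
    ext i; simp
  rw [h5, ← h3, h1] at h4
  have h6 : (((-1) ^ ((n - 1) * (n - 2) / 2) * (n ^ n * a ^ (n - 1)) : ℤ) : ℚ) =
      (-1) ^ (n * (n - 1) / 2) * ((n : ℚ) ^ n * ((-1) ^ n * -(a : ℚ)) ^ (n - 1)) := by
    obtain ⟨N, rfl⟩ : ∃ N, n = N + 1 := ⟨n - 1, by omega⟩
    have e1 : (N + 1) * (N + 1 - 1) / 2 = (N + 1 - 1) * (N + 1 - 2) / 2 + N := by
      rcases N with _ | N
      · rfl
      · change (N + 2) * (N + 1) / 2 = (N + 1) * N / 2 + (N + 1)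
        rw [show (N + 2) * (N + 1) = (N + 1) * N + (N + 1) * 2 by ring,
          Nat.add_mul_div_right _ _ two_pos]
    rw [e1, pow_add, show (-1 : ℚ) ^ (N + 1) * -(a : ℚ) = (-1) ^ N * a by ring, mul_pow,
      Nat.add_sub_cancel, ← pow_mul]
    have e2 : (-1 : ℚ) ^ N * (-1) ^ (N * N) = 1 := by
      rw [← pow_add, show N + N * N = N * (N + 1) by ring]
      exact (Nat.even_mul_succ_self N).neg_one_pow
    push_cast
    linear_combination -(-1 : ℚ) ^ (N * (N - 1) / 2) * (N + 1) ^ (N + 1) * a ^ N * e2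
  exact_mod_cast h4.trans h6.symm

/-! ### Valuations of the discriminant of a pure field -/

/-- The valuation of `d_K` read off from `disc(X ^ n - a) = ± n ^ n a ^ (n - 1)` and from the
`p`-part `p ^ σ` of the index. -/
theorem factorization_discr_of_eq {p : ℕ} (hp : p.Prime) {n : ℕ} (hn : 0 < n) {a d D ε : ℤ}
    (ha : a ≠ 0) (hε : ε.natAbs = 1) {σ : ℕ} (hD : ¬ (p : ℤ) ∣ D)
    (h : ε * (n ^ n * a ^ (n - 1)) = (p : ℤ) ^ (2 * σ) * D ^ 2 * d) :
    n * n.factorization p + (n - 1) * a.natAbs.factorization p =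
      2 * σ + d.natAbs.factorization p := by
  have hd : d ≠ 0 := by
    rintro rfl
    rw [mul_zero] at h
    have : ε ≠ 0 := by rintro rfl; simp at hε
    have : (n : ℤ) ≠ 0 := by exact_mod_cast hn.ne'
    simp_all
  have hD0 : D ≠ 0 := by rintro rfl; exact hD (dvd_zero _)
  have h1 := congrArg Int.natAbs h
  simp only [Int.natAbs_mul, Int.natAbs_pow, hε, Int.natAbs_natCast, one_mul] at h1
  have h2 := congrArg (Nat.factorization · p) h1
  beta_reduce at h2
  have hDp : D.natAbs.factorization p = 0 :=
    Nat.factorization_eq_zero_of_not_dvd fun hd => hD (Int.natCast_dvd.mpr hd)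
  rw [Nat.factorization_mul (pow_ne_zero _ hn.ne') (pow_ne_zero _ (Int.natAbs_ne_zero.mpr ha)),
    Nat.factorization_mul (mul_ne_zero (pow_ne_zero _ hp.ne_zero)
      (pow_ne_zero _ (Int.natAbs_ne_zero.mpr hD0))) (Int.natAbs_ne_zero.mpr hd),
    Nat.factorization_mul (pow_ne_zero _ hp.ne_zero)
      (pow_ne_zero _ (Int.natAbs_ne_zero.mpr hD0))] at h2
  simpa [Nat.factorization_pow, hDp, hp.factorization_self] using h2

/-- If `a ^ (p - 1) = 1`, then `a = a ^ p` and `X ^ (n / p) - a` divides `X ^ n - a`. Hence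
`v_p(a ^ (p - 1) - 1)` is not the junk value at `0` for a prime `p` dividing `n`. -/
theorem pow_sub_one_ne_one_of_irreducible {n : ℕ} {a : ℤ} (hn : 0 < n)
    (hirr : Irreducible (X ^ n - C a : ℤ[X])) {p : ℕ} (hp : p.Prime) (hpn : p ∣ n) :
    a ^ (p - 1) ≠ 1 := by
  intro h
  obtain ⟨n', rfl⟩ := hpn
  have hn' : 0 < n' := Nat.pos_of_ne_zero (by rintro rfl; simp at hn)
  have hap : a ^ p = a := by
    rw [show a ^ p = a ^ (p - 1) * a by rw [← pow_succ, Nat.sub_add_cancel hp.one_le], h, one_mul]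
  have hdvd : (X ^ n' - C a : ℤ[X]) ∣ X ^ (p * n') - C a := by
    have := sub_dvd_pow_sub_pow (X ^ n' : ℤ[X]) (C a) p
    rwa [← pow_mul, ← C_pow, hap, mul_comm n'] at this
  rcases hirr.dvd_iff.mp hdvd with h1 | h1
  · have := natDegree_eq_zero_of_isUnit h1
    rw [natDegree_X_pow_sub_C] at this
    omega
  · have := natDegree_eq_of_degree_eq (degree_eq_degree_of_associated h1)
    rw [natDegree_X_pow_sub_C, natDegree_X_pow_sub_C] at this
    have := hp.two_le
    nlinarith

end PureField

/-! ### The prime factorization of the discriminant of a pure field -/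

section PureFieldDiscriminant

open Polynomial NumberField

theorem pureDiscrExponent_of_not_dvd_left {n p : ℕ} (a : ℤ) (hpn : ¬ p ∣ n) :
    pureDiscrExponent n a p = 0 := by
  simp [pureDiscrExponent, Nat.factorization_eq_zero_of_not_dvd hpn]

theorem pureDiscrExponent_of_dvd_right {n p : ℕ} {a : ℤ} (hp : p.Prime) (hpa : (p : ℤ) ∣ a) :
    pureDiscrExponent n a p = n * n.factorization p := by
  have h : ¬ (p : ℤ) ∣ a ^ (p - 1) - 1 := fun h =>
    (Nat.prime_iff_prime_int.mp hp).not_dvd_one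
      ((dvd_sub_right (hpa.trans (dvd_pow_self a (Nat.sub_pos_of_lt hp.one_lt).ne'))).mp h)
  simp [pureDiscrExponent, wieferichExcess, padicValInt.eq_zero_of_not_dvd h]

theorem natAbs_eq_prod_pow_factorization {d : ℕ} (hd : d ≠ 0) {S : Finset ℕ}
    (hS : d.primeFactors ⊆ S) : d = ∏ p ∈ S, p ^ d.factorization p := by
  conv_lhs => rw [← Nat.prod_factorization_pow_eq_self hd]
  exact Finsupp.prod_of_support_subset _ (by simpa using hS) _ (by simp)

theorem sum_mul_pow_eq_pureDiscrExponent {n p n' s r : ℕ} {a : ℤ}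
    (hs : n.factorization p = s) (hn' : n / p ^ s = n')
    (hr : padicValInt p (a ^ (p - 1) - 1) = r + 1) :
    pureDiscrExponent n a p =
      n * s - 2 * ∑ j ∈ Finset.Icc 1 (min r s), (n' : ℤ) * (p : ℤ) ^ (s - j) := by
  have hw : wieferichExcess a p = r := by simp [wieferichExcess, hr]
  rw [pureDiscrExponent, hs, hw, hn']
  simp only [Int.toNat_natCast, ← Finset.mul_sum]
  split_ifs with h
  · ring
  · have : r = 0 := by omega
    simp [this]

variable {K : Type*} [Field K] [NumberField K] {n : ℕ} {a : ℤ} {θ : 𝓞 K}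

/-- Both exponents vanish at the primes that do not contribute to them, so that one formula covers
all primes. -/
theorem factorization_discr_pure (hn : 0 < n) (ha : a ≠ 0)
    (hirr : Irreducible (X ^ n - C a : ℤ[X])) (hroot : aeval θ (X ^ n - C a : ℤ[X]) = 0)
    (hfin : Module.finrank ℚ K = n) {ε : ℤ} (hε : ε.natAbs = 1)
    (hdisc : Algebra.discr ℤ (fun i : Fin n => θ ^ (i : ℕ)) = ε * (n ^ n * a ^ (n - 1)))
    {p : ℕ} (hp : p.Prime)
    (hcop : p ∣ n → ¬ (p : ℤ) ∣ a ∨ Nat.Coprime (padicValInt p a) p) :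
    ((discr K).natAbs.factorization p : ℤ) =
      pureDiscrExponent n a p + (n - Nat.gcd n (a.natAbs.factorization p) : ℕ) := by
  have : Fact p.Prime := ⟨hp⟩
  have hval : padicValInt p a = a.natAbs.factorization p := by
    rw [padicValInt, Nat.factorization_def _ hp]
  have ha' : a.natAbs ≠ 0 := Int.natAbs_ne_zero.mpr ha
  by_cases hpa : (p : ℤ) ∣ a
  · set t := a.natAbs.factorization p with ht
    have ht0 : 0 < t := hp.factorization_pos_of_dvd ha' (Int.natCast_dvd.mp hpa)
    have hg : ¬ p ∣ Nat.gcd n t := by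
      intro h
      have h1 := (hcop (h.trans (Nat.gcd_dvd_left _ _))).resolve_left (not_not.mpr hpa)
      rw [hval, Nat.coprime_comm, hp.coprime_iff_not_dvd] at h1
      exact h1 (h.trans (Nat.gcd_dvd_right _ _))
    obtain ⟨a₀, hat⟩ : (p : ℤ) ^ t ∣ a := by
      rw [← Int.natCast_pow, Int.natCast_dvd]
      exact Nat.ordProj_dvd _ _
    have ha₀ : ¬ (p : ℤ) ∣ a₀ := by
      rintro ⟨c, rfl⟩
      refine Nat.pow_succ_factorization_not_dvd ha' hp (Int.natCast_dvd.mp ⟨c, ?_⟩)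
      rw [← ht]
      push_cast
      linear_combination hat
    obtain ⟨D, hD, h⟩ := discr_pow_eq_of_dvd hirr hroot hfin hn ht0 hat ha₀ hg
    have key := factorization_discr_of_eq hp hn ha hε hD (hdisc.symm.trans h)
    rw [← ht] at key
    have hσ := two_mul_sum_div_add n t hn
    have hle : Nat.gcd n t ≤ n := Nat.gcd_le_left _ hn
    rw [pureDiscrExponent_of_dvd_right hp hpa]
    push_cast [hle]
    zify at key hσ
    linarith
  · have ht : a.natAbs.factorization p = 0 :=
      Nat.factorization_eq_zero_of_not_dvd fun h => hpa (Int.natCast_dvd.mpr h)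
    rw [ht, Nat.gcd_zero_right, Nat.sub_self, Nat.cast_zero, add_zero]
    by_cases hpn : p ∣ n
    · have hne : a ^ (p - 1) - 1 ≠ 0 :=
        sub_ne_zero.mpr (pow_sub_one_ne_one_of_irreducible hn hirr hp hpn)
      have hdvd : (p : ℤ) ∣ a ^ (p - 1) - 1 :=
        (Int.ModEq.pow_card_sub_one_eq_one hp
          ((Nat.prime_iff_prime_int.mp hp).coprime_iff_not_dvd.mpr hpa).symm).symm.dvd
      obtain ⟨r, hr⟩ : ∃ r, padicValInt p (a ^ (p - 1) - 1) = r + 1 := by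
        refine Nat.exists_eq_succ_of_ne_zero fun h0 => ?_
        have := (padicValInt_dvd_iff (p := p) 1 (a ^ (p - 1) - 1)).mp (by simpa using hdvd)
        omega
      have hr1 : (p : ℤ) ^ (r + 1) ∣ a ^ (p - 1) - 1 :=
        (padicValInt_dvd_iff _ _).mpr (Or.inr hr.ge)
      have hr2 : ¬ (p : ℤ) ^ (r + 2) ∣ a ^ (p - 1) - 1 := fun h => by
        have := (padicValInt_dvd_iff _ _).mp h
        omega
      have hns : n = n / p ^ n.factorization p * p ^ n.factorization p :=
        (Nat.div_mul_cancel (Nat.ordProj_dvd n p)).symm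
      obtain ⟨D, hD, h⟩ := discr_pow_eq_of_not_dvd hirr hroot hfin hns
        (Nat.ordCompl_pos p hn.ne') (Nat.not_dvd_ordCompl hp hn.ne') hpa hr1 hr2
      have key := factorization_discr_of_eq hp hn ha hε hD (hdisc.symm.trans h)
      rw [sum_mul_pow_eq_pureDiscrExponent rfl rfl hr]
      rw [ht] at key
      zify at key
      push_cast at key ⊢
      linarith
    · rw [pureDiscrExponent_of_not_dvd_left a hpn]
      obtain ⟨T, hT⟩ := exists_discr_pow_eq_sq_mul hfin θ
      refine Nat.cast_eq_zero.mpr (Nat.factorization_eq_zero_of_not_dvd fun h => ?_)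
      have h1 : (p : ℤ) ∣ ε * (n ^ n * a ^ (n - 1)) := by
        rw [← hdisc, hT]
        exact (Int.natCast_dvd.mpr h).mul_left _
      have hpp := Nat.prime_iff_prime_int.mp hp
      rcases hpp.dvd_or_dvd h1 with h2 | h2
      · rw [Int.natCast_dvd, hε] at h2
        exact hp.one_lt.not_ge (Nat.le_of_dvd one_pos h2)
      · rcases hpp.dvd_or_dvd h2 with h3 | h3
        · exact hpn (Int.natCast_dvd_natCast.mp (hpp.dvd_of_dvd_pow h3))
        · exact hpa (hpp.dvd_of_dvd_pow h3)

theorem natAbs_discr_pure (hn : 0 < n) (ha : a ≠ 0)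
    (hirr : Irreducible (X ^ n - C a : ℤ[X])) (hroot : aeval θ (X ^ n - C a : ℤ[X]) = 0)
    (hfin : Module.finrank ℚ K = n) {ε : ℤ} (hε : ε.natAbs = 1)
    (hdisc : Algebra.discr ℤ (fun i : Fin n => θ ^ (i : ℕ)) = ε * (n ^ n * a ^ (n - 1)))
    (hcop : ∀ p : ℕ, p.Prime → p ∣ n → ¬ (p : ℤ) ∣ a ∨ Nat.Coprime (padicValInt p a) p) :
    ((discr K).natAbs : ℚ) = (∏ p ∈ n.primeFactors, (p : ℚ) ^ pureDiscrExponent n a p) *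
      ∏ q ∈ a.natAbs.primeFactors, (q : ℚ) ^ (n - Nat.gcd n (a.natAbs.factorization q)) := by
  have hd : (discr K).natAbs ≠ 0 := Int.natAbs_ne_zero.mpr (discr_ne_zero K)
  set S := (discr K).natAbs.primeFactors ∪ (n.primeFactors ∪ a.natAbs.primeFactors) with hS
  have hSp : ∀ p ∈ S, p.Prime := by
    intro p hp
    simp only [hS, Finset.mem_union] at hp
    rcases hp with h | h | h <;> exact Nat.prime_of_mem_primeFactors h
  have h1 : ∏ p ∈ n.primeFactors, (p : ℚ) ^ pureDiscrExponent n a p =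
      ∏ p ∈ S, (p : ℚ) ^ pureDiscrExponent n a p := by
    refine Finset.prod_subset
      (Finset.subset_union_left.trans Finset.subset_union_right) fun p hp hpn => ?_
    rw [pureDiscrExponent_of_not_dvd_left, zpow_zero]
    exact fun h => hpn (Nat.mem_primeFactors.mpr ⟨hSp p hp, h, hn.ne'⟩)
  have h2 : ∏ q ∈ a.natAbs.primeFactors,
      (q : ℚ) ^ (n - Nat.gcd n (a.natAbs.factorization q)) =
      ∏ q ∈ S, (q : ℚ) ^ (n - Nat.gcd n (a.natAbs.factorization q)) := by
    refine Finset.prod_subset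
      (Finset.subset_union_right.trans Finset.subset_union_right) fun p hp hpa => ?_
    rw [← Nat.support_factorization, Finsupp.notMem_support_iff] at hpa
    rw [hpa, Nat.gcd_zero_right, Nat.sub_self, pow_zero]
  rw [h1, h2, ← Finset.prod_mul_distrib,
    natAbs_eq_prod_pow_factorization hd (Finset.subset_union_left : _ ⊆ S), Nat.cast_prod]
  refine Finset.prod_congr rfl fun p hp => ?_
  have hp0 : (p : ℚ) ≠ 0 := Nat.cast_ne_zero.mpr (hSp p hp).ne_zero
  rw [Nat.cast_pow, ← zpow_natCast, ← zpow_natCast, ← zpow_add₀ hp0,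
    factorization_discr_pure hn ha hirr hroot hfin hε hdisc (hSp p hp) (hcop p (hSp p hp))]

end PureFieldDiscriminant

theorem theorem1p1 {K : Type*} [Field K] [NumberField K] (n : ℕ) (a : ℤ) (θ : K)
    (hirr : Irreducible (Polynomial.X ^ n - Polynomial.C a : Polynomial ℤ))
    (hroot : Polynomial.aeval θ (Polynomial.X ^ n - Polynomial.C a : Polynomial ℤ) = 0)
    (hgen : IntermediateField.adjoin ℚ {θ} = ⊤)
    (hcop : ∀ p : ℕ, p.Prime → p ∣ n →
      ¬ (p : ℤ) ∣ a ∨ Nat.Coprime (padicValInt p a) p) :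
    (NumberField.discr K : ℚ) =
      (-1) ^ ((n - 1) * (n - 2) / 2) * ((Int.sign (a ^ (n - 1)) : ℤ) : ℚ) *
        (∏ p ∈ n.primeFactors, (p : ℚ) ^ pureDiscrExponent n a p) *
        ∏ q ∈ a.natAbs.primeFactors,
          (q : ℚ) ^ (n - Nat.gcd n (a.natAbs.factorization q)) := by
  have hn : 0 < n := by
    refine Nat.pos_of_ne_zero ?_
    rintro rfl
    have h1 : 1 - (a : K) = 0 := by simpa using hroot
    have h2 : a = 1 := by exact_mod_cast (sub_eq_zero.mp h1).symm
    simp [h2] at hirr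
  obtain ⟨θ, rfl⟩ : ∃ θ' : NumberField.RingOfIntegers K, (θ' : K) = θ :=
    ⟨⟨θ, _, Polynomial.monic_X_pow_sub_C a hn.ne',
      by simpa [Polynomial.aeval_def] using hroot⟩, rfl⟩
  obtain ⟨hfin, hdisc⟩ := discr_pow_pure hn hirr hroot hgen
  obtain ⟨T, hT⟩ := exists_discr_pow_eq_sq_mul hfin θ
  have hε : ((-1 : ℤ) ^ ((n - 1) * (n - 2) / 2)).natAbs = 1 := by simp [Int.natAbs_pow]
  -- for `n = 1` the integer `a` may vanish, and both sides are equal to `1`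
  rcases Nat.lt_or_ge 1 n with hn1 | hn1
  · have ha : a ≠ 0 := by
      rintro rfl
      rw [Polynomial.C_0, sub_zero] at hirr
      exact not_irreducible_pow hn1.ne' hirr
    have hroot' : Polynomial.aeval θ (Polynomial.X ^ n - Polynomial.C a : Polynomial ℤ) = 0 := by
      apply NumberField.RingOfIntegers.coe_injective
      simpa using hroot
    have hsign : (NumberField.discr K).sign =
        (-1) ^ ((n - 1) * (n - 2) / 2) * Int.sign (a ^ (n - 1)) := by
      have h := congrArg Int.sign (hT.symm.trans hdisc)
      have hT0 : T ≠ 0 := by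
        rintro rfl
        have := hT.symm.trans hdisc
        simp [hn.ne', ha] at this
      rw [Int.sign_mul, Int.sign_mul, Int.sign_mul,
        Int.sign_eq_one_of_pos (a := T ^ 2) (by positivity),
        Int.sign_eq_one_of_pos (a := (n : ℤ) ^ n) (by positivity), one_mul, one_mul] at h
      rw [h]
      congr 1
      rcases neg_one_pow_eq_or ℤ ((n - 1) * (n - 2) / 2) with h | h <;> simp [h]
    rw [← Int.sign_mul_natAbs (NumberField.discr K), Int.cast_mul, hsign, Int.cast_natCast,
      natAbs_discr_pure hn ha hirr hroot' hfin hε hdisc hcop]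
    push_cast
    ring
  · obtain rfl : n = 1 := by omega
    have h1 : NumberField.discr K = 1 := by
      have := hT.symm.trans hdisc
      simp only [Nat.sub_self, Nat.zero_mul, pow_zero, Nat.cast_one, one_pow,
        mul_one, Nat.zero_div] at this
      rcases Int.mul_eq_one_iff_eq_one_or_neg_one.mp this with h | h
      · exact h.2
      · nlinarith [h.1, sq_nonneg T]
    simp [h1]
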